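/- Let $a>b>0$, $c^2=a^2-b^2$, and let $\mathcal E=\{x^2/a^2+y^2/b^2=1\}$. Let $\mathcal K$ be a circle with centre $C=[x_c,y_c]$ and radius $r>0$ lying (with its disk) inside $\mathcal E$, such that there is a triangle inscribed in $\mathcal E$ whose three side lines are tangent to $\mathcal K$ (so that $\mathcal K$ is the caustic of a Poncelet family of triangles inscribed in $\mathcal E$). Assume that $C\neq\left[\pm\frac{\sqrt{(4a^2-b^2)(a^2-b^2)}}{2a},\,0\right]$. Let $\mathcal L_7$ be the set of Gergonne points $X_7$ of all triangles inscribed in $\mathcal E$ whose three side lines are tangent to $\mathcal K$; the Gergonne point of a triangle is the common point of the lines joining each vertex to the point where the opposite side touches the inscribed circle. Put $\delta=\sqrt{(b^4+c^2y_c^2)(a^4-c^2x_c^2)}$. Then $\mathcal L_7$ is an ellipse $$\left\{[x,y] : \frac{(x-x_7)^2}{b_7^2}+\frac{(y-y_7)^2}{a_7^2}=1\right\},\qquad a_7>b_7>0,$$ that is, its major (resp. minor) axis is parallel to the minor (resp. major) axis of $\mathcal E$. Its centre $[x_7,y_7]$ satisfies $$x_7=\frac{4 a x_c \left(4 a^5+a^3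 b^2+a b^4-a (4 a^2-3 b^2) x_c^2-a b^2 y_c^2-3 b \delta \right)}{a^2(4 a^2-b^2)^2-(4 a^2-3 b^2)^2 x_c^2-a^2 b^2 y_c^2},$$ where the denominator is nonzero, and $$y_7=\frac{4 b y_c \left(4 b^5+a^2 b^3+a^4 b-b (4 b^2-3 a^2) y_c^2-a^2 b x_c^2-3 a\delta\right)}{b^2 (4 b^2-a^2)^2-(3 a^2-4 b^2)^2 y_c^2-a^2 b^2 x_c^2}$$ whenever the denominator of this last fraction is nonzero. Furthermore, if $x_c\neq0$ and $y_c\neq 0$, then $x_7\ne0$ and $$\left(\frac{a_7}{b_7}\right)^2=\frac{y_7\,x_c}{x_7\,y_c}.$$ -/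

import Mathlib

/-- The Euclidean plane. -/
abbrev Plane : Type := EuclideanSpace ℝ (Fin 2)

/-- The axis-parallel ellipse with centre `[x₀, y₀]`, horizontal semi-axis `p` and vertical
semi-axis `q`. -/
def axisEllipse (x₀ y₀ p q : ℝ) : Set Plane :=
  {P | ((P 0 - x₀) / p) ^ 2 + ((P 1 - y₀) / q) ^ 2 = 1}

/-- The open region bounded by `axisEllipse x₀ y₀ p q`. -/
def axisEllipseInterior (x₀ y₀ p q : ℝ) : Set Plane :=
  {P | ((P 0 - x₀) / p) ^ 2 + ((P 1 - y₀) / q) ^ 2 < 1}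

/-- The triangles interscribed between the curve `E` and the circle `K`: the vertices lie on `E`
and the three side lines are tangent to `K`. -/
def interscribedTriangles (E : Set Plane) (K : EuclideanGeometry.Sphere Plane) :
    Set (Affine.Triangle ℝ Plane) :=
  {T | (∀ i, T.points i ∈ E) ∧
    ∀ i, K.IsTangent (affineSpan ℝ (Set.range (T.faceOpposite i).points))}

/-- `G` is the Gergonne point of `T`: it lies on each of the three lines that join a vertex to the
point where the opposite side touches the inscribed circle (`T.touchpoint ∅ i` is the
touchpoint of the inscribed circle on the side opposite to the vertex `i`). -/
def IsGergonnePoint (T : Affine.Triangle ℝ Plane) (G : Plane) : Prop :=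
  ∀ i, G ∈ affineSpan ℝ {T.points i, T.touchpoint ∅ i}

/-- The locus of the Gergonne points of the triangles interscribed between `E` and `K`. -/
def gergonneLocus (E : Set Plane) (K : EuclideanGeometry.Sphere Plane) : Set Plane :=
  {G | ∃ T ∈ interscribedTriangles E K, IsGergonnePoint T G}

/-! Normalise the circle to the unit circle of ℂ. A triangle tangent to it is encoded by its contact
points `x, y, z`, of modulus one, and its vertices are the poles `2xy/(x+y)` and so on. In this
coordinate the ellipse is `S|v|² - 2β Re v² + 4 Re(A v̄) = 4` with `β` real, and a pole lies on it
exactly when its two contact points satisfy a symmetric biquadratic relation. Three such relations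
collapse (`symm_biquadratic_triple`, `closure_of_interscribed`) to `e₁ = A + β e₃`, `e₂ = Ā e₃ + β`,
`S = 1 + β² - |A|²` for the elementary symmetric functions `eᵢ`. Conversely every unimodular `e₃`
occurs (`exists_unit_triple`), so the Poncelet family is parametrised by `e = e₃`.

Since the circle is the incircle, the Gergonne point `g` satisfies `3g + e₂ ḡ = 2e₁`. This is linear
in `e`: `e (Ā ḡ - 2β) = 2A - 3g - β ḡ`. Comparing moduli eliminates `e` and leaves a real quadratic
in `g = X + iY` without an `XY` term. Its coefficients of `X²` and `Y²` are `R₁ = (3+β)² - |A|²` and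
`R₂ = (3-β)² - |A|²`. As `β > 0`, `R₁ > R₂ > 0`, so the locus is an axis-parallel ellipse elongated
vertically, with squared axis ratio `R₁/R₂`. It would shrink to a point only for the excluded
centres. The formulas for its centre follow by expressing `a, b, xc, yc, δ` through `A = p + iq` and
`β`. -/

open ComplexConjugate

/-! ### Algebra of the closure condition -/

/-- Three distinct numbers that satisfy pairwise a symmetric biquadratic relation. -/
theorem symm_biquadratic_triple {F : Type*} [Field F] {x y z S β A A' : F}
    (hxy : x ≠ y) (hyz : y ≠ z) (hxz : x ≠ z)
    (h₁ : x * y * S - β * (1 + x ^ 2 * y ^ 2) + (A + A' * (x * y)) * (x + y) - (x + y) ^ 2 = 0)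
    (h₂ : y * z * S - β * (1 + y ^ 2 * z ^ 2) + (A + A' * (y * z)) * (y + z) - (y + z) ^ 2 = 0)
    (h₃ : x * z * S - β * (1 + x ^ 2 * z ^ 2) + (A + A' * (x * z)) * (x + z) - (x + z) ^ 2 = 0) :
    x + y + z = A + β * (x * y * z) ∧
      S - 1 - β * (x * y + y * z + x * z) + A' * (x + y + z) = 0 := by
  -- Two relations that share an unknown differ by a multiple of the difference of the other two.
  -- Dividing it out, and then once more, leaves relations of lower degree.
  have e₃ : (S - 2) * z - β * z ^ 2 * (x + y) + A + A' * z ^ 2 + A' * z * (x + y) - (x + y) = 0 := by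
    apply mul_left_cancel₀ (sub_ne_zero.2 hxy)
    linear_combination h₃ - h₂
  have e₁ : (S - 2) * x - β * x ^ 2 * (y + z) + A + A' * x ^ 2 + A' * x * (y + z) - (y + z) = 0 := by
    apply mul_left_cancel₀ (sub_ne_zero.2 hyz)
    linear_combination h₁ - h₃
  have e : S - 1 - β * (x * y + y * z + x * z) + A' * (x + y + z) = 0 := by
    apply mul_left_cancel₀ (sub_ne_zero.2 hxz)
    linear_combination e₁ - e₃
  refine ⟨?_, e⟩
  linear_combination z * e - e₃

/-- Once `A` and `S` are eliminated, the biquadratic expression is exactly the difference of the two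
sides of `h₂`. This is the converse used to put constructed vertices on the ellipse. -/
theorem symm_biquadratic_of_closure {F : Type*} [Field F] {x y z S β A A' : F}
    (h₁ : x + y + z = A + β * (x * y * z))
    (h₂ : x * y + y * z + x * z = A' * (x * y * z) + β) (hS : S = 1 + β ^ 2 - A * A') :
    x * y * S - β * (1 + x ^ 2 * y ^ 2) + (A + A' * (x * y)) * (x + y) - (x + y) ^ 2 = 0 := by
  have hA : A = x + y + z - β * (x * y * z) := by linear_combination -h₁
  have hS' : S = 1 + β * (x * y + y * z + x * z) - A' * (x + y + z) := by
    rw [hS]; linear_combination A' * h₁ - β * h₂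
  rw [hS', hA]
  linear_combination h₂

/-! ### Unimodular triples and the porism -/

theorem conj_mul_self_of_norm_one {z : ℂ} (hz : ‖z‖ = 1) : conj z * z = 1 := by
  rw [← Complex.normSq_eq_conj_mul_self, Complex.normSq_eq_norm_sq, hz]; norm_num

/-- For unimodular numbers `ē₁ e₃ = e₂` and `ē₃ e₃ = 1`, so it suffices to conjugate `h` and
multiply by `e₃`. -/
theorem conj_esymm_two {x y z A : ℂ} {β : ℝ} (hx : ‖x‖ = 1) (hy : ‖y‖ = 1) (hz : ‖z‖ = 1)
    (h : x + y + z = A + β * (x * y * z)) :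
    x * y + y * z + x * z = conj A * (x * y * z) + β := by
  have hx' := conj_mul_self_of_norm_one hx
  have hy' := conj_mul_self_of_norm_one hy
  have hz' := conj_mul_self_of_norm_one hz
  have hc := congrArg conj h
  simp only [map_add, map_mul, Complex.conj_ofReal] at hc
  have e1 : (conj x + conj y + conj z) * (x * y * z) = x * y + y * z + x * z := by
    linear_combination y * z * hx' + x * z * hy' + x * y * hz'
  have e2 : conj x * conj y * conj z * (x * y * z) = 1 := by
    linear_combination (conj y * y) * (conj z * z) * hx' + (conj z * z) * hy' + hz'
  linear_combination -e1 + x * y * z * hc + β * e2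

/-- Two unit numbers `x, y` in a triple with `e₁ = A + β e₃` are not opposite. -/
theorem add_ne_zero_of_closure {x y z A : ℂ} {β : ℝ} (hx : ‖x‖ = 1) (hz : ‖z‖ = 1)
    (hβ : 0 ≤ β) (hA : ‖A‖ < 1 - β) (h : x + y + z = A + β * (x * y * z)) : x + y ≠ 0 := by
  intro h0
  obtain rfl : y = -x := by linear_combination h0
  have e : z = A - β * (x * x * z) := by linear_combination h
  have : ‖z‖ ≤ ‖A‖ + β := by
    calc ‖z‖ = ‖A - β * (x * x * z)‖ := by rw [← e]
      _ ≤ ‖A‖ + ‖(β : ℂ) * (x * x * z)‖ := norm_sub_le _ _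
      _ = ‖A‖ + β := by simp [hx, hz, abs_of_nonneg hβ]
  linarith

/-- Two unit numbers `x, y` in a triple with `e₁ = A + β e₃` are distinct. -/
theorem ne_of_closure {x y z A : ℂ} {β : ℝ} (hx : ‖x‖ = 1) (hz : ‖z‖ = 1)
    (hβ : 0 ≤ β) (hA : ‖A‖ < 1 - β) (h : x + y + z = A + β * (x * y * z)) : x ≠ y := by
  rintro rfl
  have e : (2 : ℂ) * x = A - z + β * (x * x * z) := by linear_combination h
  have : ‖(2 : ℂ) * x‖ ≤ ‖A‖ + 1 + β := by
    rw [e]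
    calc ‖A - z + β * (x * x * z)‖ ≤ ‖A - z‖ + ‖(β : ℂ) * (x * x * z)‖ := norm_add_le _ _
      _ ≤ ‖A‖ + ‖z‖ + ‖(β : ℂ) * (x * x * z)‖ := by gcongr; exact norm_sub_le _ _
      _ = ‖A‖ + 1 + β := by simp [hx, hz, abs_of_nonneg hβ]
  simp [hx] at this
  linarith

/-- A Blaschke product argument: the cubic reads `z (z² - A z + β) = e (1 - Ā z + β z²)`, with
reciprocal quadratics. The difference of their squared moduli is `1 - |z|²` times a factor that `|A|
< 1 - β` makes positive, so neither `|z| < 1` nor `|z| > 1` is compatible with the equation. -/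
theorem norm_eq_one_of_cubic {z A e : ℂ} {β : ℝ} (he : ‖e‖ = 1)
    (hβ : 0 ≤ β) (hA : ‖A‖ < 1 - β)
    (h : z ^ 3 - (A + β * e) * z ^ 2 + (conj A * e + β) * z - e = 0) : ‖z‖ = 1 := by
  have hN : Complex.normSq z * Complex.normSq (z ^ 2 - A * z + β) =
      Complex.normSq (1 - conj A * z + β * z ^ 2) := by
    have h1 : z * (z ^ 2 - A * z + β) = e * (1 - conj A * z + β * z ^ 2) := by
      linear_combination h
    have := congrArg Complex.normSq h1
    rwa [Complex.normSq_mul, Complex.normSq_mul, Complex.normSq_eq_norm_sq e, he, one_pow,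
      one_mul] at this
  have hid : Complex.normSq (1 - conj A * z + β * z ^ 2) - Complex.normSq (z ^ 2 - A * z + β) =
      (1 - Complex.normSq z) * ((1 - β ^ 2) * (1 + Complex.normSq z)
        - 2 * (z * (conj A - β * A)).re) := by
    simp only [Complex.normSq_apply, Complex.add_re, Complex.add_im, Complex.sub_re,
      Complex.sub_im, Complex.mul_re, Complex.mul_im, Complex.conj_re, Complex.conj_im,
      Complex.ofReal_re, Complex.ofReal_im, Complex.one_re, Complex.one_im, pow_two]
    ring
  have hz0 := norm_nonneg z
  have hA0 := norm_nonneg A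
  have hre : (z * (conj A - β * A)).re ≤ ‖z‖ * ((1 + β) * ‖A‖) := by
    calc (z * (conj A - β * A)).re ≤ ‖z * (conj A - β * A)‖ := Complex.re_le_norm _
      _ = ‖z‖ * ‖conj A - β * A‖ := norm_mul _ _
      _ ≤ ‖z‖ * (‖conj A‖ + ‖(β : ℂ) * A‖) := by gcongr; exact norm_sub_le _ _
      _ = ‖z‖ * ((1 + β) * ‖A‖) := by
        rw [norm_mul, Complex.norm_conj, Complex.norm_real, Real.norm_of_nonneg hβ]; ring
  rw [Complex.normSq_eq_norm_sq z] at hN hid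
  have hpos : 0 < (1 - β ^ 2) * (1 + ‖z‖ ^ 2) - 2 * (z * (conj A - β * A)).re := by
    have h1 : ‖z‖ * ((1 + β) * ‖A‖) ≤ ‖z‖ * ((1 + β) * (1 - β)) := by gcongr
    have h2 : 0 < (1 + β) * (1 - β) := by apply mul_pos <;> linarith
    -- For `z ≠ 0` the factor exceeds `(1 - β²)(1 - |z|)²`; at `z = 0` that strict bound is lost,
    -- but the factor is at least `1 - β²`.
    rcases hz0.eq_or_lt with h0 | h0
    · rw [← h0] at hre ⊢; nlinarith
    · have h3 : ‖z‖ * ((1 + β) * ‖A‖) < ‖z‖ * ((1 + β) * (1 - β)) := by gcongr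
      nlinarith [sq_nonneg (1 - ‖z‖)]
  have hw := Complex.normSq_nonneg (z ^ 2 - A * z + β)
  set W := Complex.normSq (z ^ 2 - A * z + β)
  set V := Complex.normSq (1 - conj A * z + β * z ^ 2)
  rcases lt_trichotomy ‖z‖ 1 with h1 | h1 | h1
  · have h2 : 0 < 1 - ‖z‖ ^ 2 := by nlinarith
    have := mul_pos h2 hpos
    nlinarith
  · exact h1
  · have h2 : 0 < ‖z‖ ^ 2 - 1 := by nlinarith
    have := mul_pos h2 hpos
    nlinarith

/-- Poncelet's porism for triangles inscribed in the unit circle: each value of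
`e = x y z` on the unit circle is realised. -/
theorem exists_unit_triple {A e : ℂ} {β : ℝ} (he : ‖e‖ = 1) (hβ : 0 ≤ β) (hA : ‖A‖ < 1 - β) :
    ∃ x y z : ℂ, ‖x‖ = 1 ∧ ‖y‖ = 1 ∧ ‖z‖ = 1 ∧ x * y * z = e ∧
      x + y + z = A + β * (x * y * z) := by
  have he0 : e ≠ 0 := by rintro rfl; simp at he
  obtain ⟨x, hx⟩ : ∃ x : ℂ, x ^ 3 - (A + β * e) * x ^ 2 + (conj A * e + β) * x - e = 0 := by
    open Polynomial in
    obtain ⟨x, hx⟩ := IsAlgClosed.exists_root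
      (X ^ 3 - C (A + β * e) * X ^ 2 + C (conj A * e + β) * X - C e : ℂ[X]) (by
        have : (X ^ 3 - C (A + β * e) * X ^ 2 + C (conj A * e + β) * X - C e : ℂ[X]).degree = 3 := by
          compute_degree!
        rw [this]; norm_num)
    exact ⟨x, by simpa [Polynomial.IsRoot] using hx⟩
  have hx1 := norm_eq_one_of_cubic he hβ hA hx
  have hx0 : x ≠ 0 := by rintro rfl; simp at hx1
  -- The cubic divided by its linear factor at `x`: by Vieta the other two roots have sum `A + β e -
  -- x` and product `e / x`.
  obtain ⟨y, hy⟩ : ∃ y : ℂ, y ^ 2 - (A + β * e - x) * y + e / x = 0 := by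
    open Polynomial in
    obtain ⟨y, hy⟩ := IsAlgClosed.exists_root
      (X ^ 2 - C (A + β * e - x) * X + C (e / x) : ℂ[X]) (by
        have : (X ^ 2 - C (A + β * e - x) * X + C (e / x) : ℂ[X]).degree = 2 := by
          compute_degree!
        rw [this]; norm_num)
    exact ⟨y, by simpa [Polynomial.IsRoot] using hy⟩
  have hxe : x * (e / x) = e := by field_simp
  have root : ∀ t : ℂ, t ^ 2 - (A + β * e - x) * t + e / x = 0 → ‖t‖ = 1 := by
    intro t ht
    refine norm_eq_one_of_cubic he hβ hA (z := t) ?_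
    have h2 : x * (A + β * e - x) + e / x = conj A * e + β := by
      apply mul_left_cancel₀ hx0
      linear_combination hxe - hx
    linear_combination (t - x) * ht - t * h2 + hxe
  have hprod : y * (A + β * e - x - y) = e / x := by linear_combination -hy
  have hz : (A + β * e - x - y) ^ 2 - (A + β * e - x) * (A + β * e - x - y) + e / x = 0 := by
    linear_combination hy
  have hp : x * y * (A + β * e - x - y) = e := by rw [mul_assoc, hprod, hxe]
  refine ⟨x, y, A + β * e - x - y, hx1, root y hy, root _ hz, hp, ?_⟩
  rw [hp]; ring

/-! ### The Gergonne cevians -/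

/-- The equation, in complex coordinates, of the line that joins the contact point `w` to the
opposite vertex `2 y z / (y + z)`. -/
theorem cevian_equation {w y z g g' : ℂ} (hw : w ≠ 0) (hyz : y + z ≠ 0) :
    (g - w) * (2 / (y + z) - w⁻¹) - (g' - w⁻¹) * (2 * y * z / (y + z) - w) = 0 ↔
      g * (3 * w - (w + y + z)) - g' * (3 * (w * y * z) - (w * y + y * z + w * z) * w)
        + 2 * (w * y + y * z + w * z) - 2 * (w + y + z) * w = 0 := by
  have : (g - w) * (2 / (y + z) - w⁻¹) - (g' - w⁻¹) * (2 * y * z / (y + z) - w) =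
      (g * (3 * w - (w + y + z)) - g' * (3 * (w * y * z) - (w * y + y * z + w * z) * w)
        + 2 * (w * y + y * z + w * z) - 2 * (w + y + z) * w) / (w * (y + z)) := by
    field_simp
    ring
  rw [this, div_eq_zero_iff, or_iff_left (mul_ne_zero hw hyz)]

/-- Concurrency of the three cevians through the contact points. -/
theorem cevians_iff {e₁ e₂ e₃ g x y z : ℂ} (hxy : x ≠ y)
    (h₁ : conj e₁ * e₃ = e₂) (h₃ : conj e₃ * e₃ = 1) :
    (∀ w ∈ ({x, y, z} : Set ℂ),
      g * (3 * w - e₁) - conj g * (3 * e₃ - e₂ * w) + 2 * e₂ - 2 * e₁ * w = 0) ↔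
      3 * g + e₂ * conj g = 2 * e₁ := by
  constructor
  · intro h
    have hx := h x (by simp)
    have hy := h y (by simp)
    -- The cevian equations are affine in `w`, so two distinct values of `w` force the coefficient
    -- of `w` to vanish.
    apply mul_left_cancel₀ (sub_ne_zero.2 hxy)
    linear_combination hx - hy
  · intro h w _
    -- The constant term in `w` is `-e₃` times the conjugate of the condition `h`.
    have hc := congrArg conj h
    simp only [map_add, map_mul, Complex.conj_conj, map_ofNat] at hc
    have hc2 : conj e₂ * e₃ = e₁ := by
      rw [← h₁]; simp only [map_mul, Complex.conj_conj]; linear_combination e₁ * h₃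
    linear_combination w * h - e₃ * hc + g * hc2 - 2 * h₁

/-! ### The coordinate that makes the circle the unit circle -/

/-- The complex coordinate of a point with respect to the circle with centre `[xc, yc]` and
radius `r`, which becomes the unit circle. -/
noncomputable def circleCoord (xc yc r : ℝ) (P : Plane) : ℂ := ⟨(P 0 - xc) / r, (P 1 - yc) / r⟩

/-- The point with a given complex coordinate. -/
noncomputable def pointOfCoord (xc yc r : ℝ) (v : ℂ) : Plane := !₂[xc + r * v.re, yc + r * v.im]

section
variable {xc yc r : ℝ}

theorem circleCoord_pointOfCoord (hr : r ≠ 0) (v : ℂ) :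
    circleCoord xc yc r (pointOfCoord xc yc r v) = v := by
  apply Complex.ext <;> simp [circleCoord, pointOfCoord, hr]

theorem circleCoord_injective (hr : r ≠ 0) : Function.Injective (circleCoord xc yc r) := by
  intro P Q h
  have h0 := congrArg Complex.re h
  have h1 := congrArg Complex.im h
  simp only [circleCoord] at h0 h1
  rw [div_left_inj' hr] at h0 h1
  ext i
  fin_cases i
  · simpa using h0
  · simpa using h1

theorem circleCoord_lineMap (P Q : Plane) (t : ℝ) :
    circleCoord xc yc r (AffineMap.lineMap P Q t) =
      circleCoord xc yc r P + t * (circleCoord xc yc r Q - circleCoord xc yc r P) := by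
  apply Complex.ext <;> simp [circleCoord, AffineMap.lineMap_apply] <;> ring

/-- Collinearity means that `(g - p)/(q - p)` is real, that is, fixed by conjugation. -/
theorem mem_line_iff_circleCoord (hr : r ≠ 0) {P Q G : Plane} (hPQ : P ≠ Q) :
    G ∈ line[ℝ, P, Q] ↔
      (circleCoord xc yc r G - circleCoord xc yc r P) *
          (conj (circleCoord xc yc r Q) - conj (circleCoord xc yc r P)) -
        (conj (circleCoord xc yc r G) - conj (circleCoord xc yc r P)) *
          (circleCoord xc yc r Q - circleCoord xc yc r P) = 0 := by
  rw [mem_affineSpan_pair_iff_exists_lineMap_eq]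
  have hne : circleCoord xc yc r Q - circleCoord xc yc r P ≠ 0 :=
    sub_ne_zero.2 ((circleCoord_injective hr).ne hPQ.symm)
  constructor
  · rintro ⟨t, rfl⟩
    rw [circleCoord_lineMap]
    simp only [map_add, map_mul, map_sub, Complex.conj_ofReal]
    ring
  · intro h
    set g := circleCoord xc yc r G
    set p := circleCoord xc yc r P with hp
    set q := circleCoord xc yc r Q with hq
    have hne' : conj q - conj p ≠ 0 := by rw [← map_sub]; exact (map_ne_zero _).2 hne
    have hreal : conj ((g - p) / (q - p)) = (g - p) / (q - p) := by
      rw [map_div₀, map_sub, map_sub, div_eq_div_iff hne' hne]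
      linear_combination -h
    obtain ⟨t, ht⟩ := Complex.conj_eq_iff_real.1 hreal
    refine ⟨t, circleCoord_injective (xc := xc) (yc := yc) hr ?_⟩
    rw [circleCoord_lineMap, ← hp, ← hq, ← ht]
    field_simp
    ring

theorem norm_circleCoord_eq_one_iff (hr : 0 < r) {P : Plane} :
    ‖circleCoord xc yc r P‖ = 1 ↔ P ∈ (⟨!₂[xc, yc], r⟩ : EuclideanGeometry.Sphere Plane) := by
  rw [EuclideanGeometry.mem_sphere, EuclideanSpace.dist_eq, Real.sqrt_eq_iff_mul_self_eq_of_pos hr,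
    ← sq_eq_sq₀ (norm_nonneg _) zero_le_one, ← Complex.normSq_eq_norm_sq]
  simp only [circleCoord, Complex.normSq_mk, Fin.sum_univ_two, Real.dist_eq, sq_abs]
  simp only [Matrix.cons_val_zero, Matrix.cons_val_one]
  constructor
  · intro h
    field_simp at h
    linarith
  · intro h
    field_simp
    linarith

theorem mem_orthRadius_iff_circleCoord (hr : 0 < r) {P X : Plane}
    (hP : ‖circleCoord xc yc r P‖ = 1) :
    X ∈ (⟨!₂[xc, yc], r⟩ : EuclideanGeometry.Sphere Plane).orthRadius P ↔
      circleCoord xc yc r X * conj (circleCoord xc yc r P) +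
        conj (circleCoord xc yc r X) * circleCoord xc yc r P = 2 := by
  rw [EuclideanGeometry.Sphere.mem_orthRadius_iff_inner_left]
  have hP' : ((P 0 - xc) / r) ^ 2 + ((P 1 - yc) / r) ^ 2 = 1 := by
    have := Complex.normSq_eq_norm_sq (circleCoord xc yc r P)
    rw [hP, circleCoord, Complex.normSq_mk] at this
    linarith
  have e : circleCoord xc yc r X * conj (circleCoord xc yc r P) +
        conj (circleCoord xc yc r X) * circleCoord xc yc r P =
      ((2 * ((X 0 - xc) / r * ((P 0 - xc) / r) + (X 1 - yc) / r * ((P 1 - yc) / r)) : ℝ) : ℂ) := by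
    apply Complex.ext <;> simp [circleCoord] <;> ring
  rw [e]
  simp only [vsub_eq_sub, PiLp.inner_apply, Fin.sum_univ_two, PiLp.sub_apply,
    Matrix.cons_val_zero, Matrix.cons_val_one, RCLike.inner_apply, conj_trivial]
  have h2 : ((2 : ℝ) : ℂ) = 2 := by norm_num
  rw [← h2, Complex.ofReal_inj]
  field_simp at hP' ⊢
  constructor <;> intro h <;> linarith

theorem isTangentAt_line_of_circleCoord (hr : 0 < r) {P X Y : Plane} (hXY : X ≠ Y)
    (hP : ‖circleCoord xc yc r P‖ = 1)
    (hX : circleCoord xc yc r X * conj (circleCoord xc yc r P) +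
        conj (circleCoord xc yc r X) * circleCoord xc yc r P = 2)
    (hY : circleCoord xc yc r Y * conj (circleCoord xc yc r P) +
        conj (circleCoord xc yc r Y) * circleCoord xc yc r P = 2) :
    (⟨!₂[xc, yc], r⟩ : EuclideanGeometry.Sphere Plane).IsTangentAt P line[ℝ, X, Y] := by
  refine ⟨(norm_circleCoord_eq_one_iff hr).1 hP, ?_, ?_⟩
  · rw [mem_line_iff_circleCoord hr.ne' hXY]
    have h1 := conj_mul_self_of_norm_one hP
    set w := circleCoord xc yc r P
    set x := circleCoord xc yc r X
    set y := circleCoord xc yc r Y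
    linear_combination (-(w - x) * (conj y - conj x) + (conj w - conj x) * (y - x)) * h1
      - (y - x) * conj w * (2 * h1 - hX) + conj w * (w - x) * (hY - hX)
  · exact affineSpan_pair_le_of_mem_of_mem ((mem_orthRadius_iff_circleCoord hr hP).2 hX)
      ((mem_orthRadius_iff_circleCoord hr hP).2 hY)

end

/-! ### The circle is the incircle -/

/-- Extending a segment that starts inside an ellipse and passes through a point on it leads
outside. -/
theorem not_sbtw_axisEllipse {a b : ℝ} {X Y Z : Plane}
    (hX : X ∈ axisEllipseInterior 0 0 a b) (hY : Y ∈ axisEllipse 0 0 a b)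
    (hZ : Z ∈ axisEllipse 0 0 a b) : ¬ Sbtw ℝ X Y Z := by
  rintro ⟨⟨t, ⟨ht0, ht1⟩, rfl⟩, hne, hne'⟩
  have ht : t ≠ 1 := by rintro rfl; simp at hne'
  simp only [axisEllipse, axisEllipseInterior, Set.mem_ofPred_eq, AffineMap.lineMap_apply] at hX hY hZ
  simp at hX hY hZ
  have ht2 : 0 < 1 - t := by rcases ht1.lt_or_eq with h | h; linarith; exact absurd h ht
  -- Strict convexity made explicit: a quadratic form at a convex combination falls short of the
  -- interpolated value by `t (1 - t)` times the form at the difference.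
  have e : ((t * (Z 0 - X 0) + X 0) / a) ^ 2 + ((t * (Z 1 - X 1) + X 1) / b) ^ 2 =
      (1 - t) * ((X 0 / a) ^ 2 + (X 1 / b) ^ 2) + t * ((Z 0 / a) ^ 2 + (Z 1 / b) ^ 2)
        - t * (1 - t) * ((Z 0 / a - X 0 / a) ^ 2 + (Z 1 / b - X 1 / b) ^ 2) := by ring
  rw [e, hZ] at hY
  have h1 := mul_pos ht2 (sub_pos.2 hX)
  have h2 : 0 ≤ t * (1 - t) * ((Z 0 / a - X 0 / a) ^ 2 + (Z 1 / b - X 1 / b) ^ 2) := by positivity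
  linarith

/-- A circle inside an ellipse is the inscribed circle of each interscribed triangle. -/
theorem isTangentAt_touchpoint_of_interscribed {a b : ℝ} {K : EuclideanGeometry.Sphere Plane}
    (hK : Metric.closedBall K.center K.radius ⊆ axisEllipseInterior 0 0 a b)
    {T : Affine.Triangle ℝ Plane} (hT : T ∈ interscribedTriangles (axisEllipse 0 0 a b) K)
    (i : Fin 3) :
    K.IsTangentAt (T.touchpoint ∅ i) (affineSpan ℝ (Set.range (T.faceOpposite i).points)) := by
  obtain ⟨hE, ht⟩ := hT
  have hdist : ∀ i, dist K.center ((T.faceOpposite i).orthogonalProjectionSpan K.center) =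
      K.radius := fun i =>
    EuclideanGeometry.Sphere.dist_orthogonalProjection_eq_radius_iff_isTangent.2 (ht i)
  have htop : K.center ∈ affineSpan ℝ (Set.range T.points) := by
    rw [T.independent.affineSpan_eq_top_iff_card_eq_finrank_add_one.2 (by simp)]
    trivial
  obtain ⟨signs, -, hs⟩ :=
    (T.exists_forall_dist_eq_iff_exists_excenterExists_and_eq_excenter htop).1 ⟨_, hdist⟩
  have hc : K.center = T.incenter := by
    rcases T.excenter_eq_incenter_or_excenter_singleton signs with h | ⟨j, h⟩
    · rw [hs, h]
    · exfalso
      rw [h] at hs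
      -- For the excircle opposite `j`, vertex `l` would lie strictly between vertex `j` and the
      -- contact point on the side opposite `k`. That contact point is in the disk, hence inside the
      -- ellipse, which convexity forbids.
      obtain ⟨k, l, hjk, hjl, hkl⟩ : ∃ k l : Fin 3, j ≠ k ∧ j ≠ l ∧ k ≠ l := by
        clear h hs; decide +revert
      refine not_sbtw_axisEllipse (hK ?_) (hE l) (hE j)
        (T.touchpoint_singleton_sbtw hjk hjl hkl)
      rw [Metric.mem_closedBall, dist_comm, Affine.Simplex.touchpoint, ← hs, hdist k]
  have := EuclideanGeometry.Sphere.isTangent_iff_isTangentAt_orthogonalProjection.1 (ht i)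
  rw [hc] at this
  exact this

/-! ### Poles of chords of the unit circle on the conic -/

/-- The conic `S |v|² - 2 β Re v² + 4 Re (A v̄) = 4`. -/
def OnConic (S β : ℝ) (A v : ℂ) : Prop :=
  (S : ℂ) * (v * conj v) - β * (v ^ 2 + conj v ^ 2) + 2 * (A * conj v + conj A * v) - 4 = 0

theorem eq_inv_of_norm_one {w : ℂ} (hw : ‖w‖ = 1) : conj w = w⁻¹ :=
  eq_inv_of_mul_eq_one_left (conj_mul_self_of_norm_one hw)

theorem ne_zero_of_norm_one {w : ℂ} (hw : ‖w‖ = 1) : w ≠ 0 := by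
  rintro rfl; simp at hw

theorem conj_pole {x y : ℂ} (hx : ‖x‖ = 1) (hy : ‖y‖ = 1) (hxy : x + y ≠ 0) :
    conj (2 * x * y / (x + y)) = 2 / (x + y) := by
  have := ne_zero_of_norm_one hx
  have := ne_zero_of_norm_one hy
  have hyx : y + x ≠ 0 := by rwa [add_comm]
  simp only [map_div₀, map_mul, map_add, map_ofNat, eq_inv_of_norm_one hx, eq_inv_of_norm_one hy]
  field_simp
  rw [add_comm]

/-- At the pole, whose conjugate is `2/(x+y)`, the conic equation is the biquadratic expression
times `4/(x+y)²`. -/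
theorem onConic_pole_iff {S β : ℝ} {A x y : ℂ} (hx : ‖x‖ = 1) (hy : ‖y‖ = 1) (hxy : x + y ≠ 0) :
    OnConic S β A (2 * x * y / (x + y)) ↔
      x * y * S - β * (1 + x ^ 2 * y ^ 2) + (A + conj A * (x * y)) * (x + y) - (x + y) ^ 2 = 0 := by
  rw [OnConic, conj_pole hx hy hxy]
  have : (S : ℂ) * (2 * x * y / (x + y) * (2 / (x + y))) -
      β * ((2 * x * y / (x + y)) ^ 2 + (2 / (x + y)) ^ 2) +
      2 * (A * (2 / (x + y)) + conj A * (2 * x * y / (x + y))) - 4 =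
      (x * y * S - β * (1 + x ^ 2 * y ^ 2) + (A + conj A * (x * y)) * (x + y) - (x + y) ^ 2) *
        (4 / (x + y) ^ 2) := by
    field_simp
    ring
  rw [this, mul_eq_zero, or_iff_left]
  exact div_ne_zero (by norm_num) (pow_ne_zero 2 hxy)

/-- The common point of the tangents of the unit circle at `x` and `y`. -/
theorem eq_pole_of_tangents {x y v : ℂ} (hx : ‖x‖ = 1) (hy : ‖y‖ = 1) (hxy : x ≠ y)
    (h₁ : v * conj x + conj v * x = 2) (h₂ : v * conj y + conj v * y = 2) :
    x + y ≠ 0 ∧ v = 2 * x * y / (x + y) := by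
  have hx' := conj_mul_self_of_norm_one hx
  have hy' := conj_mul_self_of_norm_one hy
  have h0 : conj v * (x + y) = 2 := by
    apply mul_left_cancel₀ (sub_ne_zero.2 hxy)
    linear_combination x * h₁ - y * h₂ - v * hx' + v * hy'
  have hne : x + y ≠ 0 := by intro h; rw [h] at h0; simp at h0
  refine ⟨hne, ?_⟩
  rw [eq_div_iff hne]
  linear_combination x * y * h₁ + x * y * h₂ - y * v * hx' - x * v * hy' - x * y * h0

theorem pole_tangent {x y : ℂ} (hx : ‖x‖ = 1) (hy : ‖y‖ = 1) (hxy : x + y ≠ 0) :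
    2 * x * y / (x + y) * conj x + conj (2 * x * y / (x + y)) * x = 2 := by
  have := ne_zero_of_norm_one hx
  rw [conj_pole hx hy hxy, eq_inv_of_norm_one hx]
  field_simp
  ring

/-- No point lies on three distinct tangents of the unit circle. -/
theorem pole_not_on_third_tangent {x y z : ℂ} (hx : ‖x‖ = 1) (hy : ‖y‖ = 1) (hz : ‖z‖ = 1)
    (hxz : x ≠ z) (hyz : y ≠ z) (h : x + y ≠ 0) :
    2 * x * y / (x + y) * conj z + conj (2 * x * y / (x + y)) * z ≠ 2 := by
  have := ne_zero_of_norm_one hz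
  rw [conj_pole hx hy h, eq_inv_of_norm_one hz]
  intro h'
  field_simp at h'
  have : (z - x) * (z - y) = 0 := by linear_combination h'
  rcases mul_eq_zero.1 this with h1 | h1
  · exact hxz (sub_eq_zero.1 h1).symm
  · exact hyz (sub_eq_zero.1 h1).symm

/-! ### Interscribed triangles through their contact points -/

section
variable {a b xc yc r : ℝ}

theorem point_mem_affineSpan_faceOpposite (T : Affine.Triangle ℝ Plane) {i j : Fin 3}
    (hij : i ≠ j) : T.points i ∈ affineSpan ℝ (Set.range (T.faceOpposite j).points) := by
  apply subset_affineSpan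
  rw [Affine.Simplex.range_faceOpposite_points]
  exact ⟨i, by simpa using hij, rfl⟩

theorem circleCoord_touchpoint (hr : 0 < r)
    (hK : Metric.closedBall (!₂[xc, yc] : Plane) r ⊆ axisEllipseInterior 0 0 a b)
    {T : Affine.Triangle ℝ Plane}
    (hT : T ∈ interscribedTriangles (axisEllipse 0 0 a b) ⟨!₂[xc, yc], r⟩) (i : Fin 3) :
    ‖circleCoord xc yc r (T.touchpoint ∅ i)‖ = 1 :=
  (norm_circleCoord_eq_one_iff hr).2 (isTangentAt_touchpoint_of_interscribed (K := ⟨!₂[xc, yc], r⟩) hK hT i).mem_sphere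

theorem circleCoord_point (hr : 0 < r)
    (hK : Metric.closedBall (!₂[xc, yc] : Plane) r ⊆ axisEllipseInterior 0 0 a b)
    {T : Affine.Triangle ℝ Plane}
    (hT : T ∈ interscribedTriangles (axisEllipse 0 0 a b) ⟨!₂[xc, yc], r⟩) {i j k : Fin 3}
    (hij : i ≠ j) (hik : i ≠ k) (hjk : j ≠ k) :
    circleCoord xc yc r (T.touchpoint ∅ j) + circleCoord xc yc r (T.touchpoint ∅ k) ≠ 0 ∧
      circleCoord xc yc r (T.points i) =
        2 * circleCoord xc yc r (T.touchpoint ∅ j) * circleCoord xc yc r (T.touchpoint ∅ k) /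
          (circleCoord xc yc r (T.touchpoint ∅ j) + circleCoord xc yc r (T.touchpoint ∅ k)) := by
  have hj := circleCoord_touchpoint hr hK hT j
  have hk := circleCoord_touchpoint hr hK hT k
  refine eq_pole_of_tangents hj hk
    ((circleCoord_injective hr.ne').ne (T.touchpoint_empty_injective.ne hjk)) ?_ ?_
  · exact (mem_orthRadius_iff_circleCoord hr hj).1
      ((isTangentAt_touchpoint_of_interscribed (K := ⟨!₂[xc, yc], r⟩) hK hT j).le_orthRadius
        (point_mem_affineSpan_faceOpposite T hij))
  · exact (mem_orthRadius_iff_circleCoord hr hk).1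
      ((isTangentAt_touchpoint_of_interscribed (K := ⟨!₂[xc, yc], r⟩) hK hT k).le_orthRadius
        (point_mem_affineSpan_faceOpposite T hik))

/-- The Gergonne point in terms of the complex coordinates `x, y, z` of the contact points. -/
theorem isGergonnePoint_iff (hr : 0 < r)
    (hK : Metric.closedBall (!₂[xc, yc] : Plane) r ⊆ axisEllipseInterior 0 0 a b)
    {T : Affine.Triangle ℝ Plane}
    (hT : T ∈ interscribedTriangles (axisEllipse 0 0 a b) ⟨!₂[xc, yc], r⟩) {x y z : ℂ}
    (hx : circleCoord xc yc r (T.touchpoint ∅ 0) = x)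
    (hy : circleCoord xc yc r (T.touchpoint ∅ 1) = y)
    (hz : circleCoord xc yc r (T.touchpoint ∅ 2) = z) (G : Plane) :
    IsGergonnePoint T G ↔
      3 * circleCoord xc yc r G + (x * y + y * z + x * z) * conj (circleCoord xc yc r G) =
        2 * (x + y + z) := by
  have nx := circleCoord_touchpoint hr hK hT 0
  have ny := circleCoord_touchpoint hr hK hT 1
  have nz := circleCoord_touchpoint hr hK hT 2
  have h0 := circleCoord_point hr hK hT (i := 0) (j := 1) (k := 2) (by decide) (by decide)
    (by decide)
  have h1 := circleCoord_point hr hK hT (i := 1) (j := 2) (k := 0) (by decide) (by decide)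
    (by decide)
  have h2 := circleCoord_point hr hK hT (i := 2) (j := 0) (k := 1) (by decide) (by decide)
    (by decide)
  have hxy : x ≠ y := by
    rw [← hx, ← hy]
    exact (circleCoord_injective hr.ne').ne (T.touchpoint_empty_injective.ne (by decide))
  rw [hx] at nx h1 h2
  rw [hy] at ny h0 h2
  rw [hz] at nz h0 h1
  have x0 := ne_zero_of_norm_one nx
  have y0 := ne_zero_of_norm_one ny
  have z0 := ne_zero_of_norm_one nz
  rw [← cevians_iff (e₁ := x + y + z) (e₂ := x * y + y * z + x * z) (e₃ := x * y * z) (z := z) hxy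
    (by
      simp only [map_add, eq_inv_of_norm_one nx, eq_inv_of_norm_one ny, eq_inv_of_norm_one nz]
      field_simp; ring)
    (by apply conj_mul_self_of_norm_one; simp [nx, ny, nz])]
  have line_iff := fun i => mem_line_iff_circleCoord (xc := xc) (yc := yc) (G := G) hr.ne'
    (T.touchpoint_empty_ne_point i i)
  have hG : IsGergonnePoint T G ↔ ∀ i, G ∈ line[ℝ, T.touchpoint ∅ i, T.points i] :=
    forall_congr' fun i => by rw [Set.pair_comm]
  rw [hG, Fin.forall_fin_succ, Fin.forall_fin_two]
  simp only [Set.mem_insert_iff, Set.mem_singleton_iff, forall_eq_or_imp, forall_eq]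
  simp only [Fin.succ_zero_eq_one, Fin.succ_one_eq_two]
  rw [line_iff 0, line_iff 1, line_iff 2, h0.2, h1.2, h2.2, hx, hy, hz, conj_pole ny nz h0.1,
    conj_pole nz nx h1.1, conj_pole nx ny h2.1, eq_inv_of_norm_one nx, eq_inv_of_norm_one ny,
    eq_inv_of_norm_one nz, cevian_equation x0 h0.1, cevian_equation y0 h1.1,
    cevian_equation z0 h2.1]
  refine and_congr ?_ (and_congr ?_ ?_)
  · rfl
  · exact Eq.congr_left (by ring)
  · exact Eq.congr_left (by ring)

/-- The triangle formed by the tangents of a circle at three points without antipodes among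
them. -/
theorem exists_tangential_triangle (hr : 0 < r) {x y z : ℂ} (hx : ‖x‖ = 1) (hy : ‖y‖ = 1)
    (hz : ‖z‖ = 1) (hxy : x ≠ y) (hxz : x ≠ z) (hyz : y ≠ z) (hxy' : x + y ≠ 0)
    (hxz' : x + z ≠ 0) (hyz' : y + z ≠ 0) :
    ∃ T : Affine.Triangle ℝ Plane,
      (circleCoord xc yc r (T.points 0) = 2 * y * z / (y + z) ∧
        circleCoord xc yc r (T.points 1) = 2 * x * z / (x + z) ∧
        circleCoord xc yc r (T.points 2) = 2 * x * y / (x + y)) ∧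
      ∀ i, (⟨!₂[xc, yc], r⟩ : EuclideanGeometry.Sphere Plane).IsTangentAt
        (pointOfCoord xc yc r (![x, y, z] i))
        (affineSpan ℝ (Set.range (T.faceOpposite i).points)) := by
  obtain ⟨V₀, c₀⟩ : ∃ V, circleCoord xc yc r V = 2 * y * z / (y + z) :=
    ⟨_, circleCoord_pointOfCoord hr.ne' _⟩
  obtain ⟨V₁, c₁⟩ : ∃ V, circleCoord xc yc r V = 2 * x * z / (x + z) :=
    ⟨_, circleCoord_pointOfCoord hr.ne' _⟩
  obtain ⟨V₂, c₂⟩ : ∃ V, circleCoord xc yc r V = 2 * x * y / (x + y) :=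
    ⟨_, circleCoord_pointOfCoord hr.ne' _⟩
  have cx : ∀ w : ℂ, circleCoord xc yc r (pointOfCoord xc yc r w) = w :=
    circleCoord_pointOfCoord hr.ne'
  have swap : ∀ u v : ℂ, 2 * u * v / (u + v) = 2 * v * u / (v + u) := fun u v => by
    rw [add_comm u v]; ring
  have t₀y := pole_tangent hy hz hyz'
  have t₀z := pole_tangent hz hy (by rwa [add_comm])
  have t₁x := pole_tangent hx hz hxz'
  have t₁z := pole_tangent hz hx (by rwa [add_comm])
  have t₂x := pole_tangent hx hy hxy'
  have t₂y := pole_tangent hy hx (by rwa [add_comm])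
  rw [swap] at t₀z t₁z t₂y
  have h₁₂ : V₁ ≠ V₂ := by
    intro h
    apply pole_not_on_third_tangent hx hz hy hxy hyz.symm hxz'
    rw [← c₁, h, c₂, t₂y]
  have h₀₁ : V₀ ≠ V₁ := by
    intro h
    apply pole_not_on_third_tangent hy hz hx hxy.symm hxz.symm hyz'
    rw [← c₀, h, c₁, t₁x]
  have h₀₂ : V₀ ≠ V₂ := by
    intro h
    apply pole_not_on_third_tangent hy hz hx hxy.symm hxz.symm hyz'
    rw [← c₀, h, c₂, t₂x]
  have tan₀ := isTangentAt_line_of_circleCoord (xc := xc) (yc := yc) hr h₁₂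
    (P := pointOfCoord xc yc r x) (by rw [cx, hx]) (by rw [cx, c₁, t₁x]) (by rw [cx, c₂, t₂x])
  have tan₁ := isTangentAt_line_of_circleCoord (xc := xc) (yc := yc) hr h₀₂
    (P := pointOfCoord xc yc r y) (by rw [cx, hy]) (by rw [cx, c₀, t₀y]) (by rw [cx, c₂, t₂y])
  have tan₂ := isTangentAt_line_of_circleCoord (xc := xc) (yc := yc) hr h₀₁
    (P := pointOfCoord xc yc r z) (by rw [cx, hz]) (by rw [cx, c₀, t₀z]) (by rw [cx, c₁, t₁z])
  have hnot : V₂ ∉ line[ℝ, V₀, V₁] := by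
    intro h
    apply pole_not_on_third_tangent hx hy hz hxz hyz hxy'
    have := (mem_orthRadius_iff_circleCoord (P := pointOfCoord xc yc r z) hr (by rw [cx, hz])).1
      (tan₂.le_orthRadius h)
    rwa [cx, c₂] at this
  have hind : AffineIndependent ℝ ![V₀, V₁, V₂] :=
    affineIndependent_of_ne_of_mem_of_mem_of_notMem h₀₁ (left_mem_affineSpan_pair ℝ _ _)
      (right_mem_affineSpan_pair ℝ _ _) hnot
  refine ⟨⟨![V₀, V₁, V₂], hind⟩, ⟨c₀, c₁, c₂⟩, ?_⟩
  intro i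
  rw [Affine.Simplex.range_faceOpposite_points]
  have s₀ : ({0}ᶜ : Set (Fin 3)) = {1, 2} := by ext i; fin_cases i <;> simp
  have s₁ : ({1}ᶜ : Set (Fin 3)) = {0, 2} := by ext i; fin_cases i <;> simp
  have s₂ : ({2}ᶜ : Set (Fin 3)) = {0, 1} := by ext i; fin_cases i <;> simp
  fin_cases i
  · change EuclideanGeometry.Sphere.IsTangentAt _ _ (affineSpan ℝ (![V₀, V₁, V₂] '' {0}ᶜ))
    rw [s₀, Set.image_pair]; exact tan₀
  · change EuclideanGeometry.Sphere.IsTangentAt _ _ (affineSpan ℝ (![V₀, V₁, V₂] '' {1}ᶜ))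
    rw [s₁, Set.image_pair]; exact tan₁
  · change EuclideanGeometry.Sphere.IsTangentAt _ _ (affineSpan ℝ (![V₀, V₁, V₂] '' {2}ᶜ))
    rw [s₂, Set.image_pair]; exact tan₂

/-- The contact points of an interscribed triangle satisfy `e₁ = A + β e₃`. -/
theorem closure_of_interscribed (hr : 0 < r)
    (hK : Metric.closedBall (!₂[xc, yc] : Plane) r ⊆ axisEllipseInterior 0 0 a b)
    {S β : ℝ} {A : ℂ}
    (hE : ∀ P, P ∈ axisEllipse 0 0 a b ↔ OnConic S β A (circleCoord xc yc r P))
    {T : Affine.Triangle ℝ Plane}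
    (hT : T ∈ interscribedTriangles (axisEllipse 0 0 a b) ⟨!₂[xc, yc], r⟩) {x y z : ℂ}
    (hx : circleCoord xc yc r (T.touchpoint ∅ 0) = x)
    (hy : circleCoord xc yc r (T.touchpoint ∅ 1) = y)
    (hz : circleCoord xc yc r (T.touchpoint ∅ 2) = z) :
    x + y + z = A + β * (x * y * z) ∧ S = 1 + β ^ 2 - ‖A‖ ^ 2 := by
  have nx := circleCoord_touchpoint hr hK hT 0
  have ny := circleCoord_touchpoint hr hK hT 1
  have nz := circleCoord_touchpoint hr hK hT 2
  have h0 := circleCoord_point hr hK hT (i := 0) (j := 1) (k := 2) (by decide) (by decide)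
    (by decide)
  have h1 := circleCoord_point hr hK hT (i := 1) (j := 0) (k := 2) (by decide) (by decide)
    (by decide)
  have h2 := circleCoord_point hr hK hT (i := 2) (j := 0) (k := 1) (by decide) (by decide)
    (by decide)
  have ne : ∀ i j : Fin 3, i ≠ j →
      circleCoord xc yc r (T.touchpoint ∅ i) ≠ circleCoord xc yc r (T.touchpoint ∅ j) :=
    fun i j hij => (circleCoord_injective hr.ne').ne (T.touchpoint_empty_injective.ne hij)
  have hxy := ne 0 1 (by decide)
  have hyz := ne 1 2 (by decide)
  have hxz := ne 0 2 (by decide)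
  rw [hx] at nx h1 h2 hxy hxz
  rw [hy] at ny h0 h2 hxy hyz
  rw [hz] at nz h0 h1 hxz hyz
  have E0 := (hE _).1 (hT.1 0)
  have E1 := (hE _).1 (hT.1 1)
  have E2 := (hE _).1 (hT.1 2)
  rw [h0.2, onConic_pole_iff ny nz h0.1] at E0
  rw [h1.2, onConic_pole_iff nx nz h1.1] at E1
  rw [h2.2, onConic_pole_iff nx ny h2.1] at E2
  obtain ⟨c1, c2⟩ := symm_biquadratic_triple hxy hyz hxz E2 E0 E1
  refine ⟨c1, ?_⟩
  have c3 := conj_esymm_two nx ny nz c1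
  have hA : conj A * A = ((‖A‖ ^ 2 : ℝ) : ℂ) := by
    rw [← Complex.normSq_eq_conj_mul_self, Complex.normSq_eq_norm_sq]
  -- Inserting the formulas for `e₁` and `e₂` into `c2` cancels every term in `e₃`.
  have : ((S : ℝ) : ℂ) = ((1 + β ^ 2 - ‖A‖ ^ 2 : ℝ) : ℂ) := by
    rw [Complex.ofReal_sub, ← hA]
    push_cast
    linear_combination c2 + β * c3 - conj A * c1
  exact_mod_cast this

/-- The Gergonne locus in the complex coordinate. -/
theorem mem_gergonneLocus_iff (hr : 0 < r)
    (hK : Metric.closedBall (!₂[xc, yc] : Plane) r ⊆ axisEllipseInterior 0 0 a b)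
    {S β : ℝ} {A : ℂ}
    (hE : ∀ P, P ∈ axisEllipse 0 0 a b ↔ OnConic S β A (circleCoord xc yc r P))
    (hβ : 0 ≤ β) (hA : ‖A‖ < 1 - β) (hS : S = 1 + β ^ 2 - ‖A‖ ^ 2) (G : Plane) :
    G ∈ gergonneLocus (axisEllipse 0 0 a b) ⟨!₂[xc, yc], r⟩ ↔
      ∃ e : ℂ, ‖e‖ = 1 ∧ 3 * circleCoord xc yc r G +
        (conj A * e + β) * conj (circleCoord xc yc r G) = 2 * (A + β * e) := by
  constructor
  · rintro ⟨T, hT, hG⟩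
    have nx := circleCoord_touchpoint hr hK hT 0
    have ny := circleCoord_touchpoint hr hK hT 1
    have nz := circleCoord_touchpoint hr hK hT 2
    have hc := (closure_of_interscribed hr hK hE hT rfl rfl rfl).1
    have h := (isGergonnePoint_iff hr hK hT rfl rfl rfl G).1 hG
    rw [conj_esymm_two nx ny nz hc, hc] at h
    exact ⟨_, by simp [nx, ny, nz], h⟩
  · rintro ⟨e, he, h⟩
    obtain ⟨x, y, z, hx, hy, hz, rfl, hc⟩ := exists_unit_triple he hβ hA
    have hcs : (S : ℂ) = 1 + β ^ 2 - A * conj A := by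
      rw [Complex.mul_conj, Complex.normSq_eq_norm_sq, hS]; push_cast; ring
    have c₂ := conj_esymm_two hx hy hz hc
    have hc' : x + z + y = A + β * (x * z * y) := by linear_combination hc
    have hc'' : y + z + x = A + β * (y * z * x) := by linear_combination hc
    have sxy := add_ne_zero_of_closure hx hz hβ hA hc
    have sxz := add_ne_zero_of_closure hx hy hβ hA hc'
    have syz := add_ne_zero_of_closure hy hx hβ hA hc''
    obtain ⟨T, ⟨p₀, p₁, p₂⟩, ht⟩ := exists_tangential_triangle (xc := xc) (yc := yc) hr hx hy hz
      (ne_of_closure hx hz hβ hA hc) (ne_of_closure hx hy hβ hA hc')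
      (ne_of_closure hy hx hβ hA hc'') sxy sxz syz
    have hT : T ∈ interscribedTriangles (axisEllipse 0 0 a b) ⟨!₂[xc, yc], r⟩ := by
      refine ⟨?_, fun i => (ht i).isTangent⟩
      rw [Fin.forall_fin_succ, Fin.forall_fin_two]
      refine ⟨?_, ?_, ?_⟩
      · rw [hE, p₀, onConic_pole_iff hy hz syz]
        exact symm_biquadratic_of_closure hc'' (by linear_combination c₂) hcs
      · rw [hE]
        change OnConic S β A (circleCoord xc yc r (T.points 1))
        rw [p₁, onConic_pole_iff hx hz sxz]
        exact symm_biquadratic_of_closure hc' (by linear_combination c₂) hcs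
      · rw [hE]
        change OnConic S β A (circleCoord xc yc r (T.points 2))
        rw [p₂, onConic_pole_iff hx hy sxy]
        exact symm_biquadratic_of_closure hc c₂ hcs
    refine ⟨T, hT, ?_⟩
    -- A line is tangent to the circle at one point only, so the prescribed contact points are the
    -- incircle's touchpoints.
    have touch : ∀ i, circleCoord xc yc r (T.touchpoint ∅ i) = ![x, y, z] i := fun i => by
      rw [(isTangentAt_touchpoint_of_interscribed (K := ⟨!₂[xc, yc], r⟩) hK hT i).eq_of_isTangentAt (ht i),
        circleCoord_pointOfCoord hr.ne']
    rw [isGergonnePoint_iff hr hK hT (touch 0) (touch 1) (touch 2)]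
    change 3 * circleCoord xc yc r G + (x * y + y * z + x * z) * conj (circleCoord xc yc r G) =
      2 * (x + y + z)
    rw [c₂, hc, h]

end

/-! ### Metric data of the pair in terms of `p, q, β` -/

section
variable {a b xc yc r : ℝ}

theorem onConic_iff_real {S β p q X Y : ℝ} :
    OnConic S β ⟨p, q⟩ ⟨X, Y⟩ ↔
      (S - 2 * β) * X ^ 2 + (S + 2 * β) * Y ^ 2 + 4 * p * X + 4 * q * Y - 4 = 0 := by
  rw [OnConic]
  have : (S : ℂ) * ((⟨X, Y⟩ : ℂ) * conj (⟨X, Y⟩ : ℂ)) -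
      β * ((⟨X, Y⟩ : ℂ) ^ 2 + conj (⟨X, Y⟩ : ℂ) ^ 2) +
      2 * ((⟨p, q⟩ : ℂ) * conj (⟨X, Y⟩ : ℂ) + conj (⟨p, q⟩ : ℂ) * (⟨X, Y⟩ : ℂ)) - 4 =
      (((S - 2 * β) * X ^ 2 + (S + 2 * β) * Y ^ 2 + 4 * p * X + 4 * q * Y - 4 : ℝ) : ℂ) := by
    apply Complex.ext <;> simp [pow_two] <;> ring
  rw [this, Complex.ofReal_eq_zero]

/-- Here `-k` is the value of `x²/a² + y²/b² - 1` at the circle's centre; scaling by `4/k` makes the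
constant term `-4`, and the other parameters are read off. -/
theorem mem_axisEllipse_iff_onConic (ha : a ≠ 0) (hb : b ≠ 0) (hr : r ≠ 0) {k : ℝ}
    (hk : k = 1 - xc ^ 2 / a ^ 2 - yc ^ 2 / b ^ 2) (hk0 : k ≠ 0) (P : Plane) :
    P ∈ axisEllipse 0 0 a b ↔
      OnConic (2 * r ^ 2 * (1 / a ^ 2 + 1 / b ^ 2) / k) (r ^ 2 * (1 / b ^ 2 - 1 / a ^ 2) / k)
        ⟨2 * r * xc / (a ^ 2 * k), 2 * r * yc / (b ^ 2 * k)⟩ (circleCoord xc yc r P) := by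
  rw [circleCoord, onConic_iff_real]
  have e0 : P 0 = xc + r * ((P 0 - xc) / r) := by field_simp; ring
  have e1 : P 1 = yc + r * ((P 1 - yc) / r) := by field_simp; ring
  change ((P 0 - 0) / a) ^ 2 + ((P 1 - 0) / b) ^ 2 = 1 ↔ _
  set X := (P 0 - xc) / r
  set Y := (P 1 - yc) / r
  rw [e0, e1]
  have : (2 * r ^ 2 * (1 / a ^ 2 + 1 / b ^ 2) / k - 2 * (r ^ 2 * (1 / b ^ 2 - 1 / a ^ 2) / k)) * X ^ 2
      + (2 * r ^ 2 * (1 / a ^ 2 + 1 / b ^ 2) / k + 2 * (r ^ 2 * (1 / b ^ 2 - 1 / a ^ 2) / k)) * Y ^ 2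
      + 4 * (2 * r * xc / (a ^ 2 * k)) * X + 4 * (2 * r * yc / (b ^ 2 * k)) * Y - 4 =
      4 / k * (((xc + r * X - 0) / a) ^ 2 + ((yc + r * Y - 0) / b) ^ 2 - 1) := by
    have h4 : (4 : ℝ) = 4 / k * (1 - xc ^ 2 / a ^ 2 - yc ^ 2 / b ^ 2) := by
      rw [← hk]; field_simp
    nth_rw 3 [h4]
    field_simp
    ring
  rw [this, mul_eq_zero, or_iff_right (by positivity), sub_eq_zero]

/-- The circle lies inside the ellipse, expressed through the vertical diameter. -/
theorem radius_lt_of_nested (hr : 0 < r)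
    (hK : Metric.closedBall (!₂[xc, yc] : Plane) r ⊆ axisEllipseInterior 0 0 a b) :
    r ^ 2 / b ^ 2 < 1 - xc ^ 2 / a ^ 2 - yc ^ 2 / b ^ 2 := by
  have mem : ∀ s : ℝ, s ^ 2 = r ^ 2 → (!₂[xc, yc + s] : Plane) ∈ axisEllipseInterior 0 0 a b := by
    intro s hs
    apply hK
    rw [Metric.mem_closedBall, EuclideanSpace.dist_eq]
    have hs' : |s| = r := by rw [(sq_eq_sq_iff_abs_eq_abs s r).1 hs, abs_of_pos hr]
    simp [Fin.sum_univ_two, Real.sqrt_sq_eq_abs, hs', abs_of_pos hr]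
  have h1 := mem r rfl
  have h2 := mem (-r) (by ring)
  simp only [axisEllipseInterior, Set.mem_ofPred_eq, Matrix.cons_val_zero,
    Matrix.cons_val_one] at h1 h2
  have e : ((xc - 0) / a) ^ 2 + ((yc + r - 0) / b) ^ 2 +
      (((xc - 0) / a) ^ 2 + ((yc + -r - 0) / b) ^ 2) =
      2 * (xc ^ 2 / a ^ 2 + yc ^ 2 / b ^ 2 + r ^ 2 / b ^ 2) := by ring
  linarith

/-- The metric data of the pair (ellipse, circle) in terms of the parameters `p, q, β` of the
Poncelet family. -/
structure PonceletParams (a b xc yc r p q β P Q L u : ℝ) : Prop where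
  beta_pos : 0 < β
  beta_lt : β < 1
  P_eq : P = (1 - β) ^ 2 - (p ^ 2 + q ^ 2)
  Q_eq : Q = (1 + β) ^ 2 - (p ^ 2 + q ^ 2)
  L_eq : L = P * Q + p ^ 2 * Q + q ^ 2 * P
  P_pos : 0 < P
  u_pos : 0 < u
  a_sq : a ^ 2 = u * Q
  b_sq : b ^ 2 = u * P
  xc_eq : xc * P = 2 * r * p
  yc_eq : yc * Q = 2 * r * q
  xc_sq : L * xc ^ 2 = u * p ^ 2 * Q ^ 2
  yc_sq : L * yc ^ 2 = u * q ^ 2 * P ^ 2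

/-- By `hS`, `P = S - 2β` and `Q = S + 2β` (`S` being the left side of `hS`) are the coefficients of
`X²` and `Y²` in the normalised conic, namely `4r²/(a²k)` and `4r²/(b²k)`. -/
theorem PonceletParams.mk_of_closure (hb : 0 < b) (hab : b < a) (hr : 0 < r) {k p q β P Q : ℝ}
    (hk : k = 1 - xc ^ 2 / a ^ 2 - yc ^ 2 / b ^ 2) (hk0 : r ^ 2 / b ^ 2 < k)
    (hp : p = 2 * r * xc / (a ^ 2 * k)) (hq : q = 2 * r * yc / (b ^ 2 * k))
    (hβ : β = r ^ 2 * (1 / b ^ 2 - 1 / a ^ 2) / k)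
    (hS : 2 * r ^ 2 * (1 / a ^ 2 + 1 / b ^ 2) / k = 1 + β ^ 2 - (p ^ 2 + q ^ 2))
    (hP : P = (1 - β) ^ 2 - (p ^ 2 + q ^ 2)) (hQ : Q = (1 + β) ^ 2 - (p ^ 2 + q ^ 2)) :
    PonceletParams a b xc yc r p q β P Q (P * Q + p ^ 2 * Q + q ^ 2 * P)
      (4 * r ^ 2 * (P * Q + p ^ 2 * Q + q ^ 2 * P) / (P ^ 2 * Q ^ 2)) := by
  have ha : 0 < a := hb.trans hab
  have hkp : 0 < k := lt_trans (by positivity) hk0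
  have hP' : P = 4 * r ^ 2 / (a ^ 2 * k) := by
    have : P = 2 * r ^ 2 * (1 / a ^ 2 + 1 / b ^ 2) / k - 2 * β := by rw [hS, hP]; ring
    rw [this, hβ]; field_simp; ring
  have hQ' : Q = 4 * r ^ 2 / (b ^ 2 * k) := by
    have : Q = 2 * r ^ 2 * (1 / a ^ 2 + 1 / b ^ 2) / k + 2 * β := by rw [hS, hQ]; ring
    rw [this, hβ]; field_simp; ring
  have hP0 : 0 < P := by rw [hP']; positivity
  have hQ0 : 0 < Q := by rw [hQ']; positivity
  have hβ0 : 0 < β := by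
    have : Q - P = 4 * β := by rw [hP, hQ]; ring
    have h2 : P < Q := by
      rw [hP', hQ']
      have : b ^ 2 * k < a ^ 2 * k := by gcongr
      gcongr
    linarith
  have hQ4 : Q < 4 := by
    rw [div_lt_iff₀ (by positivity)] at hk0
    rw [hQ', div_lt_iff₀ (by positivity)]
    linarith
  -- `4β = Q - P` with `P > 0` and, by nesting, `Q < 4`.
  have hβ1 : β < 1 := by nlinarith
  have ea : a ^ 2 * k * P = 4 * r ^ 2 := by rw [hP']; field_simp
  have eb : b ^ 2 * k * Q = 4 * r ^ 2 := by rw [hQ']; field_simp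
  have ex : xc * P = 2 * r * p := by rw [hP', hp]; field_simp; ring
  have ey : yc * Q = 2 * r * q := by rw [hQ', hq]; field_simp; ring
  have hkL : k * (P * Q + p ^ 2 * Q + q ^ 2 * P) = P * Q := by
    have h1 : xc ^ 2 / a ^ 2 * P = k * p ^ 2 := by
      rw [div_mul_eq_mul_div, div_eq_iff (by positivity)]
      apply mul_right_cancel₀ hP0.ne'
      linear_combination (xc * P + 2 * r * p) * ex - p ^ 2 * ea
    have h2 : yc ^ 2 / b ^ 2 * Q = k * q ^ 2 := by
      rw [div_mul_eq_mul_div, div_eq_iff (by positivity)]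
      apply mul_right_cancel₀ hQ0.ne'
      linear_combination (yc * Q + 2 * r * q) * ey - q ^ 2 * eb
    linear_combination P * Q * hk - Q * h1 - P * h2
  set L := P * Q + p ^ 2 * Q + q ^ 2 * P with hL
  have hL0 : 0 < L := by positivity
  refine ⟨hβ0, hβ1, hP, hQ, rfl, hP0, by positivity, ?_, ?_, ex, ey, ?_, ?_⟩
  · field_simp
    apply mul_right_cancel₀ hkp.ne'
    linear_combination P * Q * ea - 4 * r ^ 2 * hkL
  · field_simp
    apply mul_right_cancel₀ hkp.ne'
    linear_combination P * Q * eb - 4 * r ^ 2 * hkL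
  · field_simp
    linear_combination (xc * P + 2 * r * p) * ex
  · field_simp
    linear_combination (yc * Q + 2 * r * q) * ey

namespace PonceletParams

variable {p q β P Q L u δ : ℝ}

theorem Q_pos (h : PonceletParams a b xc yc r p q β P Q L u) : 0 < Q := by
  have := h.P_pos
  have h2 : Q = P + 4 * β := by rw [h.P_eq, h.Q_eq]; ring
  have := h.beta_pos
  linarith

theorem L_pos (h : PonceletParams a b xc yc r p q β P Q L u) : 0 < L := by
  have := h.P_pos
  have := h.Q_pos
  rw [h.L_eq]; positivity

theorem normSq_lt (h : PonceletParams a b xc yc r p q β P Q L u) : p ^ 2 + q ^ 2 < (1 - β) ^ 2 := by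
  have := h.P_pos
  rw [h.P_eq] at this
  linarith

theorem normSq_lt_one (h : PonceletParams a b xc yc r p q β P Q L u) : p ^ 2 + q ^ 2 < 1 := by
  have := h.normSq_lt
  have := h.beta_pos
  have := h.beta_lt
  nlinarith

theorem plus_pos (h : PonceletParams a b xc yc r p q β P Q L u)
    : 0 < (3 + β) ^ 2 - (p ^ 2 + q ^ 2) := by
  have := h.normSq_lt_one
  have := h.beta_pos
  nlinarith

theorem minus_pos (h : PonceletParams a b xc yc r p q β P Q L u)
    : 0 < (3 - β) ^ 2 - (p ^ 2 + q ^ 2) := by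
  have := h.normSq_lt_one
  have := h.beta_lt
  nlinarith

/-- Multiplied by `L`, the two factors under the root become `u²P²Q(1-β)²` and `u²Q²P(1+β)²`;
together with `a²b² = u²PQ` this makes `a b δ` rational in the parameters. -/
theorem mul_delta (h : PonceletParams a b xc yc r p q β P Q L u) (ha : 0 < a) (hb : 0 < b)
    (hδ : δ = √((b ^ 4 + (a ^ 2 - b ^ 2) * yc ^ 2) * (a ^ 4 - (a ^ 2 - b ^ 2) * xc ^ 2))) :
    L * (a * b * δ) = u ^ 3 * P ^ 2 * Q ^ 2 * (1 - β ^ 2) := by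
  have hL := h.L_pos
  have hP := h.P_pos
  have hQ := h.Q_pos
  have hu := h.u_pos
  have hβ := h.beta_pos
  have hβ1 := h.beta_lt
  have hc : a ^ 2 - b ^ 2 = 4 * β * u := by
    rw [h.a_sq, h.b_sq, h.P_eq, h.Q_eq]; ring
  have e1 : L * (b ^ 4 + (a ^ 2 - b ^ 2) * yc ^ 2) = u ^ 2 * P ^ 2 * Q * (1 - β) ^ 2 := by
    have : b ^ 4 = (u * P) ^ 2 := by rw [← h.b_sq]; ring
    rw [hc, this]
    linear_combination 4 * β * u * h.yc_sq + u ^ 2 * P ^ 2 * h.L_eq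
      + u ^ 2 * P ^ 2 * q ^ 2 * (h.P_eq - h.Q_eq) + u ^ 2 * P ^ 2 * Q * h.P_eq
  have e2 : L * (a ^ 4 - (a ^ 2 - b ^ 2) * xc ^ 2) = u ^ 2 * Q ^ 2 * P * (1 + β) ^ 2 := by
    have : a ^ 4 = (u * Q) ^ 2 := by rw [← h.a_sq]; ring
    rw [hc, this]
    linear_combination -4 * β * u * h.xc_sq + u ^ 2 * Q ^ 2 * h.L_eq
      - u ^ 2 * Q ^ 2 * p ^ 2 * (h.P_eq - h.Q_eq) + u ^ 2 * Q ^ 2 * P * h.Q_eq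
  have p1 : 0 ≤ b ^ 4 + (a ^ 2 - b ^ 2) * yc ^ 2 := by
    rw [← mul_nonneg_iff_of_pos_left hL, e1]; positivity
  have p2 : 0 ≤ a ^ 4 - (a ^ 2 - b ^ 2) * xc ^ 2 := by
    rw [← mul_nonneg_iff_of_pos_left hL, e2]; positivity
  have hδ0 : 0 ≤ δ := by rw [hδ]; positivity
  have hδ2 : δ ^ 2 = (b ^ 4 + (a ^ 2 - b ^ 2) * yc ^ 2) * (a ^ 4 - (a ^ 2 - b ^ 2) * xc ^ 2) := by
    rw [hδ, Real.sq_sqrt (mul_nonneg p1 p2)]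
  have h1 : 0 ≤ 1 - β ^ 2 := by nlinarith
  rw [← sq_eq_sq₀ (by positivity) (by positivity)]
  calc (L * (a * b * δ)) ^ 2 = a ^ 2 * b ^ 2 * (L ^ 2 * δ ^ 2) := by ring
    _ = a ^ 2 * b ^ 2 * ((L * (b ^ 4 + (a ^ 2 - b ^ 2) * yc ^ 2)) *
          (L * (a ^ 4 - (a ^ 2 - b ^ 2) * xc ^ 2))) := by rw [hδ2]; ring
    _ = _ := by rw [e1, e2, h.a_sq, h.b_sq]; ring

theorem mul_denominator_x (h : PonceletParams a b xc yc r p q β P Q L u) :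
    L * (a ^ 2 * (4 * a ^ 2 - b ^ 2) ^ 2 - (4 * a ^ 2 - 3 * b ^ 2) ^ 2 * xc ^ 2
        - a ^ 2 * b ^ 2 * yc ^ 2) =
      u ^ 3 * P * Q ^ 2 * ((3 + β) ^ 2 - (p ^ 2 + q ^ 2)) * ((1 + 3 * β) ^ 2 - (p ^ 2 + q ^ 2)) := by
  rw [h.a_sq, h.b_sq]
  have : L * (u * Q * (4 * (u * Q) - u * P) ^ 2 - (4 * (u * Q) - 3 * (u * P)) ^ 2 * xc ^ 2
        - u * Q * (u * P) * yc ^ 2) =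
      u ^ 3 * (Q * (4 * Q - P) ^ 2 * L - (4 * Q - 3 * P) ^ 2 * p ^ 2 * Q ^ 2
        - P * Q * q ^ 2 * P ^ 2) := by
    linear_combination -(4 * (u * Q) - 3 * (u * P)) ^ 2 * h.xc_sq - u * Q * (u * P) * h.yc_sq
  rw [this, h.L_eq, h.P_eq, h.Q_eq]
  ring

/-- The last factor can vanish, and it alone can make the denominator zero. It also divides the
numerator (`mul_numerator_y`), so it cancels in the centre. Its counterpart for `x` is positive. -/
theorem mul_denominator_y (h : PonceletParams a b xc yc r p q β P Q L u) :
    L * (b ^ 2 * (4 * b ^ 2 - a ^ 2) ^ 2 - (3 * a ^ 2 - 4 * b ^ 2) ^ 2 * yc ^ 2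
        - a ^ 2 * b ^ 2 * xc ^ 2) =
      u ^ 3 * Q * P ^ 2 * ((3 - β) ^ 2 - (p ^ 2 + q ^ 2)) * ((1 - 3 * β) ^ 2 - (p ^ 2 + q ^ 2)) := by
  rw [h.a_sq, h.b_sq]
  have : L * (u * P * (4 * (u * P) - u * Q) ^ 2 - (3 * (u * Q) - 4 * (u * P)) ^ 2 * yc ^ 2
        - u * Q * (u * P) * xc ^ 2) =
      u ^ 3 * (P * (4 * P - Q) ^ 2 * L - (3 * Q - 4 * P) ^ 2 * q ^ 2 * P ^ 2
        - P * Q * p ^ 2 * Q ^ 2) := by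
    linear_combination -(3 * (u * Q) - 4 * (u * P)) ^ 2 * h.yc_sq - u * Q * (u * P) * h.xc_sq
  rw [this, h.L_eq, h.P_eq, h.Q_eq]
  ring

theorem mul_numerator_x (h : PonceletParams a b xc yc r p q β P Q L u)
    (hδ : L * (a * b * δ) = u ^ 3 * P ^ 2 * Q ^ 2 * (1 - β ^ 2)) :
    L * (a * (4 * a ^ 5 + a ^ 3 * b ^ 2 + a * b ^ 4 - a * (4 * a ^ 2 - 3 * b ^ 2) * xc ^ 2
        - a * b ^ 2 * yc ^ 2 - 3 * b * δ)) =
      u ^ 3 * P * Q ^ 2 * (3 + β ^ 2 - (p ^ 2 + q ^ 2)) * ((1 + 3 * β) ^ 2 - (p ^ 2 + q ^ 2)) := by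
  have : L * (a * (4 * a ^ 5 + a ^ 3 * b ^ 2 + a * b ^ 4 - a * (4 * a ^ 2 - 3 * b ^ 2) * xc ^ 2
        - a * b ^ 2 * yc ^ 2 - 3 * b * δ)) =
      L * (4 * (a ^ 2) ^ 3 + (a ^ 2) ^ 2 * b ^ 2 + a ^ 2 * (b ^ 2) ^ 2
        - a ^ 2 * (4 * a ^ 2 - 3 * b ^ 2) * xc ^ 2 - a ^ 2 * b ^ 2 * yc ^ 2)
        - 3 * (L * (a * b * δ)) := by ring
  rw [this, hδ, h.a_sq, h.b_sq]
  have : L * (4 * (u * Q) ^ 3 + (u * Q) ^ 2 * (u * P) + u * Q * (u * P) ^ 2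
        - u * Q * (4 * (u * Q) - 3 * (u * P)) * xc ^ 2 - u * Q * (u * P) * yc ^ 2) =
      u ^ 3 * (L * (4 * Q ^ 3 + Q ^ 2 * P + Q * P ^ 2) - Q * (4 * Q - 3 * P) * p ^ 2 * Q ^ 2
        - Q * P * q ^ 2 * P ^ 2) := by
    linear_combination -u * Q * (4 * (u * Q) - 3 * (u * P)) * h.xc_sq
      - u * Q * (u * P) * h.yc_sq
  rw [this, h.L_eq, h.P_eq, h.Q_eq]
  ring

theorem mul_numerator_y (h : PonceletParams a b xc yc r p q β P Q L u)
    (hδ : L * (a * b * δ) = u ^ 3 * P ^ 2 * Q ^ 2 * (1 - β ^ 2)) :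
    L * (b * (4 * b ^ 5 + a ^ 2 * b ^ 3 + a ^ 4 * b - b * (4 * b ^ 2 - 3 * a ^ 2) * yc ^ 2
        - a ^ 2 * b * xc ^ 2 - 3 * a * δ)) =
      u ^ 3 * Q * P ^ 2 * (3 + β ^ 2 - (p ^ 2 + q ^ 2)) * ((1 - 3 * β) ^ 2 - (p ^ 2 + q ^ 2)) := by
  have : L * (b * (4 * b ^ 5 + a ^ 2 * b ^ 3 + a ^ 4 * b - b * (4 * b ^ 2 - 3 * a ^ 2) * yc ^ 2
        - a ^ 2 * b * xc ^ 2 - 3 * a * δ)) =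
      L * (4 * (b ^ 2) ^ 3 + (b ^ 2) ^ 2 * a ^ 2 + b ^ 2 * (a ^ 2) ^ 2
        - b ^ 2 * (4 * b ^ 2 - 3 * a ^ 2) * yc ^ 2 - a ^ 2 * b ^ 2 * xc ^ 2)
        - 3 * (L * (a * b * δ)) := by ring
  rw [this, hδ, h.a_sq, h.b_sq]
  have : L * (4 * (u * P) ^ 3 + (u * P) ^ 2 * (u * Q) + u * P * (u * Q) ^ 2
        - u * P * (4 * (u * P) - 3 * (u * Q)) * yc ^ 2 - u * Q * (u * P) * xc ^ 2) =
      u ^ 3 * (L * (4 * P ^ 3 + P ^ 2 * Q + P * Q ^ 2) - P * (4 * P - 3 * Q) * q ^ 2 * P ^ 2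
        - Q * P * p ^ 2 * Q ^ 2) := by
    linear_combination -u * P * (4 * (u * P) - 3 * (u * Q)) * h.yc_sq
      - u * Q * (u * P) * h.xc_sq
  rw [this, h.L_eq, h.P_eq, h.Q_eq]
  ring

/-- Since `2rp = xc P`, the left side is `xc (R₁ + 3P)/R₁`, and `R₁ + 3P = 4(3 + β² - |A|²)`. -/
theorem center_x (h : PonceletParams a b xc yc r p q β P Q L u) :
    xc + 6 * r * p / ((3 + β) ^ 2 - (p ^ 2 + q ^ 2)) =
      4 * xc * (3 + β ^ 2 - (p ^ 2 + q ^ 2)) / ((3 + β) ^ 2 - (p ^ 2 + q ^ 2)) := by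
  have := h.plus_pos.ne'
  field_simp
  linear_combination -3 * h.xc_eq + 3 * xc * h.P_eq

theorem center_y (h : PonceletParams a b xc yc r p q β P Q L u) :
    yc + 6 * r * q / ((3 - β) ^ 2 - (p ^ 2 + q ^ 2)) =
      4 * yc * (3 + β ^ 2 - (p ^ 2 + q ^ 2)) / ((3 - β) ^ 2 - (p ^ 2 + q ^ 2)) := by
  have := h.minus_pos.ne'
  field_simp
  linear_combination -3 * h.yc_eq + 3 * yc * h.Q_eq

theorem numerator_pos (h : PonceletParams a b xc yc r p q β P Q L u)
    : 0 < 3 + β ^ 2 - (p ^ 2 + q ^ 2) := by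
  linarith only [h.normSq_lt_one, sq_nonneg β]

theorem denominator_x_ne_zero (h : PonceletParams a b xc yc r p q β P Q L u) :
    a ^ 2 * (4 * a ^ 2 - b ^ 2) ^ 2 - (4 * a ^ 2 - 3 * b ^ 2) ^ 2 * xc ^ 2
        - a ^ 2 * b ^ 2 * yc ^ 2 ≠ 0 := by
  intro h0
  have hden := h.mul_denominator_x
  have := h.u_pos
  have := h.P_pos
  have := h.Q_pos
  have := h.plus_pos
  have : 0 < (1 + 3 * β) ^ 2 - (p ^ 2 + q ^ 2) := by
    linarith only [h.normSq_lt_one, h.beta_pos, sq_nonneg β]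
  rw [h0, mul_zero] at hden
  exact absurd hden (by positivity)

theorem center_x_eq (h : PonceletParams a b xc yc r p q β P Q L u)
    (hδ : L * (a * b * δ) = u ^ 3 * P ^ 2 * Q ^ 2 * (1 - β ^ 2)) :
    xc + 6 * r * p / ((3 + β) ^ 2 - (p ^ 2 + q ^ 2)) =
      4 * a * xc * (4 * a ^ 5 + a ^ 3 * b ^ 2 + a * b ^ 4
            - a * (4 * a ^ 2 - 3 * b ^ 2) * xc ^ 2 - a * b ^ 2 * yc ^ 2 - 3 * b * δ)
          / (a ^ 2 * (4 * a ^ 2 - b ^ 2) ^ 2 - (4 * a ^ 2 - 3 * b ^ 2) ^ 2 * xc ^ 2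
            - a ^ 2 * b ^ 2 * yc ^ 2) := by
  rw [h.center_x, div_eq_div_iff h.plus_pos.ne' h.denominator_x_ne_zero]
  apply mul_left_cancel₀ h.L_pos.ne'
  linear_combination 4 * xc * (3 + β ^ 2 - (p ^ 2 + q ^ 2)) * h.mul_denominator_x
    - 4 * xc * ((3 + β) ^ 2 - (p ^ 2 + q ^ 2)) * h.mul_numerator_x hδ

theorem center_y_eq (h : PonceletParams a b xc yc r p q β P Q L u)
    (hδ : L * (a * b * δ) = u ^ 3 * P ^ 2 * Q ^ 2 * (1 - β ^ 2))
    (hD : b ^ 2 * (4 * b ^ 2 - a ^ 2) ^ 2 - (3 * a ^ 2 - 4 * b ^ 2) ^ 2 * yc ^ 2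
      - a ^ 2 * b ^ 2 * xc ^ 2 ≠ 0) :
    yc + 6 * r * q / ((3 - β) ^ 2 - (p ^ 2 + q ^ 2)) =
      4 * b * yc * (4 * b ^ 5 + a ^ 2 * b ^ 3 + a ^ 4 * b
              - b * (4 * b ^ 2 - 3 * a ^ 2) * yc ^ 2 - a ^ 2 * b * xc ^ 2 - 3 * a * δ)
            / (b ^ 2 * (4 * b ^ 2 - a ^ 2) ^ 2 - (3 * a ^ 2 - 4 * b ^ 2) ^ 2 * yc ^ 2
              - a ^ 2 * b ^ 2 * xc ^ 2) := by
  rw [h.center_y, div_eq_div_iff h.minus_pos.ne' hD]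
  apply mul_left_cancel₀ h.L_pos.ne'
  linear_combination 4 * yc * (3 + β ^ 2 - (p ^ 2 + q ^ 2)) * h.mul_denominator_y
    - 4 * yc * ((3 - β) ^ 2 - (p ^ 2 + q ^ 2)) * h.mul_numerator_y hδ

theorem center_x_ne_zero (h : PonceletParams a b xc yc r p q β P Q L u) (hxc : xc ≠ 0) :
    xc + 6 * r * p / ((3 + β) ^ 2 - (p ^ 2 + q ^ 2)) ≠ 0 := by
  rw [h.center_x]
  exact div_ne_zero (mul_ne_zero (mul_ne_zero four_ne_zero hxc) h.numerator_pos.ne')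
    h.plus_pos.ne'

/-- Both centre coordinates carry the same factor `4(3 + β² - |A|²)`, which cancels. -/
theorem center_ratio (h : PonceletParams a b xc yc r p q β P Q L u) (hxc : xc ≠ 0) (hyc : yc ≠ 0) :
    ((3 + β) ^ 2 - (p ^ 2 + q ^ 2)) / ((3 - β) ^ 2 - (p ^ 2 + q ^ 2)) =
      (yc + 6 * r * q / ((3 - β) ^ 2 - (p ^ 2 + q ^ 2))) * xc /
        ((xc + 6 * r * p / ((3 + β) ^ 2 - (p ^ 2 + q ^ 2))) * yc) := by
  rw [h.center_x, h.center_y]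
  have := h.plus_pos.ne'
  have := h.minus_pos.ne'
  have := h.numerator_pos.ne'
  field_simp

/-- The exceptional parameters belong to the circles with a stationary Gergonne point. -/
theorem not_stationary (h : PonceletParams a b xc yc r p q β P Q L u)
    (hiso : ¬ (4 * a ^ 2 * xc ^ 2 = (4 * a ^ 2 - b ^ 2) * (a ^ 2 - b ^ 2) ∧ yc = 0)) :
    ¬ (q = 0 ∧ p ^ 2 = β * (3 + β)) := by
  rintro ⟨rfl, hp⟩
  apply hiso
  constructor
  · apply mul_left_cancel₀ h.L_pos.ne'
    have hP : P = 1 - 5 * β := by rw [h.P_eq, hp]; ring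
    have hQ : Q = 1 - β := by rw [h.Q_eq, hp]; ring
    have hL : L = (1 - β) ^ 3 := by rw [h.L_eq, hp, hP, hQ]; ring
    have := h.xc_sq
    rw [hp] at this
    rw [h.a_sq, h.b_sq]
    calc L * (4 * (u * Q) * xc ^ 2) = 4 * u * Q * (L * xc ^ 2) := by ring
      _ = _ := by rw [this, hL, hP, hQ]; ring
  · have := h.yc_eq
    simpa [h.Q_pos.ne'] using this

/-- This constant, left after completing squares in the locus equation, is a positive multiple of
`R₂(|A|² - β(3+β))² + 108 β q²`, which vanishes only in the excluded case. -/
theorem discr_pos (h : PonceletParams a b xc yc r p q β P Q L u)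
    (hns : ¬ (q = 0 ∧ p ^ 2 = β * (3 + β))) :
    0 < 36 * p ^ 2 / ((3 + β) ^ 2 - (p ^ 2 + q ^ 2)) + 36 * q ^ 2 / ((3 - β) ^ 2 - (p ^ 2 + q ^ 2))
      - (4 * (p ^ 2 + q ^ 2) - 4 * β ^ 2) := by
  have h1 := h.plus_pos
  have h2 := h.minus_pos
  have hβ := h.beta_pos
  have : 36 * p ^ 2 / ((3 + β) ^ 2 - (p ^ 2 + q ^ 2)) +
      36 * q ^ 2 / ((3 - β) ^ 2 - (p ^ 2 + q ^ 2)) - (4 * (p ^ 2 + q ^ 2) - 4 * β ^ 2) =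
      4 * (((3 - β) ^ 2 - (p ^ 2 + q ^ 2)) * (p ^ 2 + q ^ 2 - β * (3 + β)) ^ 2 + 108 * β * q ^ 2) /
        (((3 + β) ^ 2 - (p ^ 2 + q ^ 2)) * ((3 - β) ^ 2 - (p ^ 2 + q ^ 2))) := by
    have := h1.ne'
    have := h2.ne'
    field_simp
    ring
  rw [this]
  refine div_pos (mul_pos four_pos ?_) (mul_pos h1 h2)
  by_cases hq : q = 0
  · subst hq
    have : p ^ 2 - β * (3 + β) ≠ 0 := fun h0 => hns ⟨rfl, by linarith⟩
    have h3 : p ^ 2 + 0 ^ 2 - β * (3 + β) ≠ 0 := by simpa using this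
    positivity
  · positivity

end PonceletParams

/-! ### Eliminating the parameter `e` -/

theorem exists_unit_mul_eq_iff {v w : ℂ} (h : ¬ (v = 0 ∧ w = 0)) :
    (∃ e : ℂ, ‖e‖ = 1 ∧ e * v = w) ↔ Complex.normSq v = Complex.normSq w := by
  constructor
  · rintro ⟨e, he, rfl⟩
    rw [Complex.normSq_mul, Complex.normSq_eq_norm_sq e, he]; ring
  · intro hvw
    have hv : v ≠ 0 := by
      rintro rfl
      rw [map_zero, eq_comm, Complex.normSq_eq_zero] at hvw
      exact h ⟨rfl, hvw⟩
    have hn : ‖v‖ = ‖w‖ := by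
      rw [← sq_eq_sq₀ (norm_nonneg _) (norm_nonneg _), ← Complex.normSq_eq_norm_sq,
        ← Complex.normSq_eq_norm_sq, hvw]
    refine ⟨w / v, ?_, div_mul_cancel₀ _ hv⟩
    rw [norm_div, hn, div_self]
    rw [← hn]; exact norm_ne_zero_iff.2 hv

/-- The equation has the form `e v = w` with `v = Ā ḡ - 2β` and `w = 2A - 3g - β ḡ`; in `|v|² =
|w|²` the `XY` terms cancel. -/
theorem PonceletParams.exists_unit_iff {p q β P Q L u : ℝ}
    (h : PonceletParams a b xc yc r p q β P Q L u)
    (hns : ¬ (q = 0 ∧ p ^ 2 = β * (3 + β))) (X Y : ℝ) :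
    (∃ e : ℂ, ‖e‖ = 1 ∧ 3 * (⟨X, Y⟩ : ℂ) + (conj (⟨p, q⟩ : ℂ) * e + β) * conj (⟨X, Y⟩ : ℂ) =
        2 * (⟨p, q⟩ + β * e)) ↔
      ((3 + β) ^ 2 - (p ^ 2 + q ^ 2)) * X ^ 2 + ((3 - β) ^ 2 - (p ^ 2 + q ^ 2)) * Y ^ 2
        - 12 * p * X - 12 * q * Y + 4 * (p ^ 2 + q ^ 2) - 4 * β ^ 2 = 0 := by
  have hβ := h.beta_pos
  have hβ1 := h.beta_lt
  have e1 : ∀ e : ℂ, (3 * (⟨X, Y⟩ : ℂ) + (conj (⟨p, q⟩ : ℂ) * e + β) * conj (⟨X, Y⟩ : ℂ) =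
        2 * (⟨p, q⟩ + β * e)) ↔
      e * (⟨p * X - q * Y - 2 * β, -(p * Y + q * X)⟩ : ℂ) =
        ⟨2 * p - (3 + β) * X, 2 * q - (3 - β) * Y⟩ := by
    intro e
    rw [Complex.ext_iff, Complex.ext_iff]
    simp
    constructor
    · rintro ⟨h1, h2⟩
      exact ⟨by linarith, by linarith⟩
    · rintro ⟨h1, h2⟩
      exact ⟨by linarith, by linarith⟩
  simp only [e1]
  rw [exists_unit_mul_eq_iff]
  · rw [Complex.normSq_mk, Complex.normSq_mk]
    constructor <;> intro h <;> linarith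
  · rintro ⟨h1, h2⟩
    rw [Complex.ext_iff] at h1 h2
    obtain ⟨a1, a2⟩ := h1
    obtain ⟨b1, b2⟩ := h2
    simp only [Complex.zero_re, Complex.zero_im] at a1 a2 b1 b2
    -- Eliminating `X, Y` from `v = w = 0` leaves two conditions on `p, q`. By the sign of `hrel`,
    -- `p = 0` is impossible, so `q = 0` and the excluded case results.
    have hpq : 12 * (p * q) = 0 := by
      linear_combination -(3 + β) * (3 - β) * a2 + (3 + β) * p * b2 + (3 - β) * q * b1
    have hrel : (3 - β) * p ^ 2 - (3 + β) * q ^ 2 = β * (3 + β) * (3 - β) := by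
      linear_combination (3 + β) * (3 - β) / 2 * a1 + (3 - β) * p / 2 * b1 - (3 + β) * q / 2 * b2
    have h3 : 0 < 3 - β := by linarith
    have hq : q = 0 := by
      rcases mul_eq_zero.1 ((mul_eq_zero.1 hpq).resolve_left (by norm_num)) with h0 | h0
      · subst h0
        have : 0 < β * (3 + β) * (3 - β) := by positivity
        have : 0 ≤ (3 + β) * q ^ 2 := by positivity
        nlinarith
      · exact h0
    subst hq
    refine hns ⟨rfl, ?_⟩
    apply mul_left_cancel₀ h3.ne'
    linear_combination hrel

theorem mem_axisEllipse_iff_completed_square {R₁ R₂ H p q c X Y : ℝ} (hr : 0 < r) (h₁ : 0 < R₁)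
    (h₂ : 0 < R₂) (hH : H = 36 * p ^ 2 / R₁ + 36 * q ^ 2 / R₂ - c) (hH0 : 0 < H) (G : Plane)
    (hX : X = (G 0 - xc) / r) (hY : Y = (G 1 - yc) / r) :
    G ∈ axisEllipse (xc + 6 * r * p / R₁) (yc + 6 * r * q / R₂) (r * √(H / R₁)) (r * √(H / R₂)) ↔
      R₁ * X ^ 2 + R₂ * Y ^ 2 - 12 * p * X - 12 * q * Y + c = 0 := by
  have e0 : G 0 = xc + r * X := by rw [hX]; field_simp; ring
  have e1 : G 1 = yc + r * Y := by rw [hY]; field_simp; ring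
  change ((G 0 - _) / _) ^ 2 + ((G 1 - _) / _) ^ 2 = 1 ↔ _
  rw [e0, e1, div_pow, div_pow, mul_pow, mul_pow, Real.sq_sqrt (by positivity),
    Real.sq_sqrt (by positivity)]
  have : (xc + r * X - (xc + 6 * r * p / R₁)) ^ 2 / (r ^ 2 * (H / R₁)) +
      (yc + r * Y - (yc + 6 * r * q / R₂)) ^ 2 / (r ^ 2 * (H / R₂)) - 1 =
      (R₁ * X ^ 2 + R₂ * Y ^ 2 - 12 * p * X - 12 * q * Y + c) / H := by
    have hc : c = 36 * p ^ 2 / R₁ + 36 * q ^ 2 / R₂ - H := by linarith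
    rw [hc]
    field_simp
    ring
  rw [← sub_eq_zero, this, div_eq_zero_iff, or_iff_left hH0.ne']

end

/-! ### Assembly -/

theorem mainTheorem8 (a b xc yc r δ : ℝ) (hb : 0 < b) (hab : b < a) (hr : 0 < r)
    -- the circular caustic lies inside the ellipse `E` with semi-axes `a`, `b`
    (hnested : Metric.closedBall (!₂[xc, yc] : Plane) r ⊆ axisEllipseInterior 0 0 a b)
    -- the pair admits a Poncelet triangle
    (hponcelet : (interscribedTriangles (axisEllipse 0 0 a b) ⟨!₂[xc, yc], r⟩).Nonempty)
    -- the caustic is not one of the two for which the Gergonne point is stationary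
    (hiso : ¬ (4 * a ^ 2 * xc ^ 2 = (4 * a ^ 2 - b ^ 2) * (a ^ 2 - b ^ 2) ∧ yc = 0))
    (hδ : δ = √((b ^ 4 + (a ^ 2 - b ^ 2) * yc ^ 2) * (a ^ 4 - (a ^ 2 - b ^ 2) * xc ^ 2))) :
    ∃ x₇ y₇ a₇ b₇ : ℝ, 0 < b₇ ∧ b₇ < a₇ ∧
      -- the minor semi-axis `b₇` is horizontal, the major semi-axis `a₇` is vertical
      gergonneLocus (axisEllipse 0 0 a b) ⟨!₂[xc, yc], r⟩ = axisEllipse x₇ y₇ b₇ a₇ ∧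
      a ^ 2 * (4 * a ^ 2 - b ^ 2) ^ 2 - (4 * a ^ 2 - 3 * b ^ 2) ^ 2 * xc ^ 2
        - a ^ 2 * b ^ 2 * yc ^ 2 ≠ 0 ∧
      x₇ = 4 * a * xc * (4 * a ^ 5 + a ^ 3 * b ^ 2 + a * b ^ 4
            - a * (4 * a ^ 2 - 3 * b ^ 2) * xc ^ 2 - a * b ^ 2 * yc ^ 2 - 3 * b * δ)
          / (a ^ 2 * (4 * a ^ 2 - b ^ 2) ^ 2 - (4 * a ^ 2 - 3 * b ^ 2) ^ 2 * xc ^ 2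
            - a ^ 2 * b ^ 2 * yc ^ 2) ∧
      (b ^ 2 * (4 * b ^ 2 - a ^ 2) ^ 2 - (3 * a ^ 2 - 4 * b ^ 2) ^ 2 * yc ^ 2
          - a ^ 2 * b ^ 2 * xc ^ 2 ≠ 0 →
        y₇ = 4 * b * yc * (4 * b ^ 5 + a ^ 2 * b ^ 3 + a ^ 4 * b
              - b * (4 * b ^ 2 - 3 * a ^ 2) * yc ^ 2 - a ^ 2 * b * xc ^ 2 - 3 * a * δ)
            / (b ^ 2 * (4 * b ^ 2 - a ^ 2) ^ 2 - (3 * a ^ 2 - 4 * b ^ 2) ^ 2 * yc ^ 2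
              - a ^ 2 * b ^ 2 * xc ^ 2)) ∧
      (xc ≠ 0 → yc ≠ 0 → x₇ ≠ 0 ∧ (a₇ / b₇) ^ 2 = y₇ * xc / (x₇ * yc)) := by
  have ha : 0 < a := hb.trans hab
  have hk0 := radius_lt_of_nested hr hnested
  obtain ⟨k, hk⟩ : ∃ k, k = 1 - xc ^ 2 / a ^ 2 - yc ^ 2 / b ^ 2 := ⟨_, rfl⟩
  rw [← hk] at hk0
  have hk1 : 0 < k := lt_trans (by positivity) hk0
  have hE := mem_axisEllipse_iff_onConic ha.ne' hb.ne' hr.ne' hk hk1.ne'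
  obtain ⟨p, hp⟩ : ∃ p, p = 2 * r * xc / (a ^ 2 * k) := ⟨_, rfl⟩
  obtain ⟨q, hq⟩ : ∃ q, q = 2 * r * yc / (b ^ 2 * k) := ⟨_, rfl⟩
  obtain ⟨β, hβ⟩ : ∃ β, β = r ^ 2 * (1 / b ^ 2 - 1 / a ^ 2) / k := ⟨_, rfl⟩
  rw [← hp, ← hq, ← hβ] at hE
  obtain ⟨T, hT⟩ := hponcelet
  have hn : ‖(⟨p, q⟩ : ℂ)‖ ^ 2 = p ^ 2 + q ^ 2 := by
    rw [← Complex.normSq_eq_norm_sq, Complex.normSq_mk]; ring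
  have hS := (closure_of_interscribed hr hnested hE hT rfl rfl rfl).2
  obtain ⟨P, Q, L, u, h⟩ : ∃ P Q L u, PonceletParams a b xc yc r p q β P Q L u :=
    ⟨_, _, _, _, PonceletParams.mk_of_closure hb hab hr hk hk0 hp hq hβ (by rw [hS, hn]) rfl rfl⟩
  have hns := h.not_stationary hiso
  have hA : ‖(⟨p, q⟩ : ℂ)‖ < 1 - β := by
    rw [← sq_lt_sq₀ (norm_nonneg _) (sub_nonneg.2 h.beta_lt.le), hn]
    exact h.normSq_lt
  have hβ0 := h.beta_pos
  have hLδ := h.mul_delta ha hb hδ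
  have hratio := h.center_ratio
  have hH := h.discr_pos hns
  have hloc := fun G => mem_axisEllipse_iff_completed_square (xc := xc) (yc := yc) (p := p) (q := q) hr h.plus_pos
    h.minus_pos rfl hH G rfl rfl
  have hx0 := h.center_x_ne_zero
  have hx := h.center_x_eq hLδ
  have hy := h.center_y_eq hLδ
  have hmem := h.exists_unit_iff hns
  -- The difference is `12β > 0`; the smaller coefficient belongs to `Y²`, which makes the vertical
  -- semi-axis the longer one.
  have hlt : (3 - β) ^ 2 - (p ^ 2 + q ^ 2) < (3 + β) ^ 2 - (p ^ 2 + q ^ 2) := by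
    linarith only [hβ0]
  obtain ⟨R₁, hR₁⟩ : ∃ R, R = (3 + β) ^ 2 - (p ^ 2 + q ^ 2) := ⟨_, rfl⟩
  obtain ⟨R₂, hR₂⟩ : ∃ R, R = (3 - β) ^ 2 - (p ^ 2 + q ^ 2) := ⟨_, rfl⟩
  have h₁ := h.plus_pos
  have h₂ := h.minus_pos
  simp only [← hR₁, ← hR₂] at *
  obtain ⟨H, hHdef⟩ : ∃ H, H = 36 * p ^ 2 / R₁ + 36 * q ^ 2 / R₂
    - (4 * (p ^ 2 + q ^ 2) - 4 * β ^ 2) := ⟨_, rfl⟩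
  simp only [← hHdef] at hH hloc
  refine ⟨xc + 6 * r * p / R₁, yc + 6 * r * q / R₂, r * √(H / R₂), r * √(H / R₁), by positivity,
    ?_, ?_, h.denominator_x_ne_zero, hx, hy, fun hxc hyc => ⟨hx0 hxc, ?_⟩⟩
  · gcongr
  · ext G
    rw [mem_gergonneLocus_iff hr hnested hE hβ0.le hA hS, hloc, circleCoord, hmem]
    constructor <;> intro h <;> linarith only [h]
  · rw [← hratio hxc hyc, div_pow, mul_pow, mul_pow, Real.sq_sqrt (by positivity),
      Real.sq_sqrt (by positivity)]
    field_simp
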